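/- Conventions. All vector spaces are over $\mathbb{Q}$. For a graded vector space $V=\bigoplus_{n\ge 1}V^n$ let $\Lambda V=\wedge V^{\mathrm{odd}}\otimes\mathbb{Q}[V^{\mathrm{even}}]$ be the free commutative graded algebra on $V$. A Sullivan algebra $(\Lambda V,d)$ is $\Lambda V$ with a derivation $d$ of degree $1$, $d^2=0$, such that $V$ is the union of graded subspaces $V(0)\subseteq V(1)\subseteq\cdots$ with $dV(0)=0$ and $dV(k+1)\subseteq\Lambda V(k)$. It is minimal if $\operatorname{im} d\subseteq\Lambda^{\ge 2}V$; pure if $dV^{\mathrm{even}}=0$ and $dV^{\mathrm{odd}}\subseteq\Lambda V^{\mathrm{even}}$; elliptic if $V$ and $H(\Lambda V,d)$ are finite-dimensional, in which case its homotopy Euler characteristic is $\chi_\pi(\Lambda V,d)=\dim V^{\mathrm{odd}}-\dim V^{\mathrm{even}}$. For pure $(\Lambda V,d)$, let $H_i(\Lambda V,d)\subseteq H(\Lambda V,d)$ be the subspace of classes represented by cocycles in $\Lambda V^{\mathrm{even}}\otimes\Lambda^iV^{\mathrm{odd}}$, and let $H^{\mathrm{even}}(\Lambda V,d)$ be the subspace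 of classes of even (upper) degree. Let $(\Lambda V,d)$ be a pure elliptic Sullivan algebra. (a) $H_0(\Lambda V,d)=H^{\mathrm{even}}(\Lambda V,d)$ if and only if $\chi_\pi(\Lambda V,d)\le 1$. (b) Suppose that $(\Lambda V,d)$ is moreover minimal, and let $$(\Lambda V,d)\;\cong\;(\Lambda V',d)\otimes(\Lambda\langle x_i\rangle_{1\le i\le k},0)$$ be an isomorphism of commutative differential graded algebras, where $k\ge 0$, the $x_i$ have positive degrees, and $(\Lambda V',d)$ is a pure elliptic minimal Sullivan algebra (for instance, such a splitting with $k$ maximal). Put $r=\chi_\pi(\Lambda V',d)$. Then $$H_0(\Lambda V,d)=H^{\mathrm{even}}(\Lambda V,d)\iff k+r\le 1\iff\chi_\pi(\Lambda V,d)\le 1 .$$ More precisely, if $r\le 1$, then $H^{\mathrm{even}}(\Lambda V',d)=H_0(\Lambda V',d)$. If $r>1$, then there are $s>0$ and a class $0\ne x\in H_s(\Lambda V',d)$ of even degree that is not representable by $\Lambda (V')^{\mathrm{even}}$ and whose image in $H(\Lambda V,d)$ is not representable by $\Lambda V^{\mathrm{even}}$. -/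

import Mathlib

open scoped TensorProduct DirectSum

noncomputable section

namespace RHT

universe u v w

/-! A graded rational vector space is a family `V : ℕ → Type u` of rational vector spaces. -/

section FreeAlgebra

variable (V : ℕ → Type u) [∀ n, AddCommGroup (V n)] [∀ n, Module ℚ (V n)]

/-- `V^even`, the direct sum of the components of even degree. -/
abbrev EvenPart : Type u := ⨁ n : {n : ℕ // Even n}, V n.1

/-- `V^odd`, the direct sum of the components of odd degree. -/
abbrev OddPart : Type u := ⨁ n : {n : ℕ // ¬ Even n}, V n.1

/-- The free commutative graded algebra `ΛV`: the exterior algebra of `V^odd` tensored with the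
polynomial (symmetric) algebra of `V^even`. The elements of the second factor have even degree,
so the ordinary tensor product of algebras carries the right signs. -/
def FreeCGA : Type u := ExteriorAlgebra ℚ (OddPart V) ⊗[ℚ] SymmetricAlgebra ℚ (EvenPart V)

instance : Ring (FreeCGA V) :=
  inferInstanceAs (Ring (ExteriorAlgebra ℚ (OddPart V) ⊗[ℚ] SymmetricAlgebra ℚ (EvenPart V)))

instance : Algebra ℚ (FreeCGA V) :=
  inferInstanceAs (Algebra ℚ (ExteriorAlgebra ℚ (OddPart V) ⊗[ℚ] SymmetricAlgebra ℚ (EvenPart V)))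

/-- The inclusion of the exterior algebra of `V^odd`, `a ↦ a ⊗ 1`. -/
def oddIncl : ExteriorAlgebra ℚ (OddPart V) →ₐ[ℚ] FreeCGA V :=
  (Algebra.TensorProduct.includeLeft : ExteriorAlgebra ℚ (OddPart V) →ₐ[ℚ]
    ExteriorAlgebra ℚ (OddPart V) ⊗[ℚ] SymmetricAlgebra ℚ (EvenPart V))

/-- The inclusion of the symmetric algebra of `V^even`, `b ↦ 1 ⊗ b`. -/
def evenIncl : SymmetricAlgebra ℚ (EvenPart V) →ₐ[ℚ] FreeCGA V :=
  (Algebra.TensorProduct.includeRight : SymmetricAlgebra ℚ (EvenPart V) →ₐ[ℚ]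
    ExteriorAlgebra ℚ (OddPart V) ⊗[ℚ] SymmetricAlgebra ℚ (EvenPart V))

/-- The inclusion `V^n → ΛV` of the generators of degree `n`. -/
def gen (n : ℕ) : V n →ₗ[ℚ] FreeCGA V :=
  if h : Even n then
    (evenIncl V).toLinearMap ∘ₗ SymmetricAlgebra.ι ℚ (EvenPart V) ∘ₗ
      DirectSum.lof ℚ {n : ℕ // Even n} (fun m => V m.1) ⟨n, h⟩
  else
    (oddIncl V).toLinearMap ∘ₗ ExteriorAlgebra.ι ℚ ∘ₗ
      DirectSum.lof ℚ {n : ℕ // ¬ Even n} (fun m => V m.1) ⟨n, h⟩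

/-- The degree-`m` component `(ΛV)^m`: the span of the products of generators whose degrees add up
to `m`. -/
def degreePart (m : ℕ) : Submodule ℚ (FreeCGA V) :=
  Submodule.span ℚ {a | ∃ l : List (Σ n, V n),
    (l.map Sigma.fst).sum = m ∧ (l.map fun x => gen V x.1 x.2).prod = a}

/-- The subalgebra `ΛV^even ⊆ ΛV`. -/
def evenSubalgebra : Subalgebra ℚ (FreeCGA V) := (evenIncl V).range

/-- `ΛV^even ⊗ Λ^i V^odd ⊆ ΛV`, the span of the products of an element of `Λ^i V^odd` and an
element of `ΛV^even`. -/
def lowerPart (i : ℕ) : Submodule ℚ (FreeCGA V) :=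
  (⋀[ℚ]^i (OddPart V)).map (oddIncl V).toLinearMap * Subalgebra.toSubmodule (evenSubalgebra V)

/-- `V` as a subspace of `ΛV`. -/
def genSpan : Submodule ℚ (FreeCGA V) := ⨆ n, LinearMap.range (gen V n)

/-- `Λ^{≥ q} V`, the span of the products of at least `q` elements of `V`. -/
def wordGE (q : ℕ) : Submodule ℚ (FreeCGA V) := ⨆ p, ⨆ _ : q ≤ p, genSpan V ^ p

/-- For a graded subspace `F ⊆ V`, the subalgebra `ΛF ⊆ ΛV` generated by `F`. -/
def subAlg (F : ∀ n, Submodule ℚ (V n)) : Subalgebra ℚ (FreeCGA V) :=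
  Algebra.adjoin ℚ {a | ∃ n, ∃ x ∈ F n, gen V n x = a}

/-- A Sullivan algebra `(ΛV, d)`: `V` is concentrated in positive degrees, `d` is a derivation of
degree `1` with `d² = 0`, and the nilpotence condition holds: `V` is the union of an increasing
sequence of graded subspaces `F 0 ⊆ F 1 ⊆ …` with `d (F 0) = 0` and `d (F (k+1)) ⊆ Λ(F k)`. -/
structure SullivanAlgebra where
  d : FreeCGA V →ₗ[ℚ] FreeCGA V
  subsingleton_zero : Subsingleton (V 0)
  d_mem : ∀ n, ∀ a ∈ degreePart V n, d a ∈ degreePart V (n + 1)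
  leibniz : ∀ n, ∀ a ∈ degreePart V n, ∀ b, d (a * b) = d a * b + (-1 : ℚ) ^ n • (a * d b)
  d_d : ∀ a, d (d a) = 0
  nilpotence : ∃ F : ℕ → ∀ n, Submodule ℚ (V n),
    Monotone F ∧ (∀ n (x : V n), ∃ k, x ∈ F k n) ∧
    (∀ n, ∀ x ∈ F 0 n, d (gen V n x) = 0) ∧
    ∀ k n, ∀ x ∈ F (k + 1) n, d (gen V n x) ∈ subAlg V (F k)

/-- The Sullivan algebra `(ΛV, 0)`. -/
def zeroDiff (h : Subsingleton (V 0)) : SullivanAlgebra V where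
  d := 0
  subsingleton_zero := h
  d_mem := by intros; simp
  leibniz := by intros; simp
  d_d := by intros; simp
  nilpotence := ⟨fun _ _ => ⊤, monotone_const, by simp, by simp, by simp⟩

end FreeAlgebra

namespace SullivanAlgebra

variable {V : ℕ → Type u} [∀ n, AddCommGroup (V n)] [∀ n, Module ℚ (V n)]

/-- The cohomology `H(ΛV, d) = ker d / im d`. -/
abbrev Cohomology (A : SullivanAlgebra V) : Type u :=
  LinearMap.ker A.d ⧸ (LinearMap.range A.d).comap (LinearMap.ker A.d).subtype

/-- The subspace of the cohomology classes that are represented by a cocycle lying in `S`. -/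
def classesIn (A : SullivanAlgebra V) (S : Submodule ℚ (FreeCGA V)) :
    Submodule ℚ A.Cohomology :=
  (S.comap (LinearMap.ker A.d).subtype).map (Submodule.mkQ _)

/-- `H^n(ΛV, d)`, for the usual (upper) grading. -/
def upperH (A : SullivanAlgebra V) (n : ℕ) : Submodule ℚ A.Cohomology :=
  A.classesIn (degreePart V n)

/-- `H^even(ΛV, d)`. -/
def evenH (A : SullivanAlgebra V) : Submodule ℚ A.Cohomology :=
  ⨆ n, ⨆ _ : Even n, A.upperH n

/-- `H_i(ΛV, d)`: the classes represented by cocycles in `ΛV^even ⊗ Λ^i V^odd`. In particular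
`H_0(ΛV, d)` consists of the classes represented by `ΛV^even`. -/
def lowerH (A : SullivanAlgebra V) (i : ℕ) : Submodule ℚ A.Cohomology :=
  A.classesIn (lowerPart V i)

/-- `(ΛV, d)` is pure: `d V^even = 0` and `d V^odd ⊆ ΛV^even`. -/
def IsPure (A : SullivanAlgebra V) : Prop :=
  (∀ n, Even n → ∀ x : V n, A.d (gen V n x) = 0) ∧
  (∀ n, Odd n → ∀ x : V n, A.d (gen V n x) ∈ evenSubalgebra V)

/-- `(ΛV, d)` is minimal: `im d ⊆ Λ^{≥ 2} V`. -/
def IsMinimal (A : SullivanAlgebra V) : Prop := LinearMap.range A.d ≤ wordGE V 2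

/-- `(ΛV, d)` is elliptic: `V` and `H(ΛV, d)` are finite-dimensional. -/
def IsElliptic (A : SullivanAlgebra V) : Prop :=
  Module.Finite ℚ (⨁ n, V n) ∧ Module.Finite ℚ A.Cohomology

/-- The homotopy Euler characteristic `dim V^odd - dim V^even` (for finite-dimensional `V`). -/
def homotopyEuler (_A : SullivanAlgebra V) : ℤ :=
  (Module.finrank ℚ (OddPart V) : ℤ) - (Module.finrank ℚ (EvenPart V) : ℤ)

end SullivanAlgebra

section Morphisms

variable {V : ℕ → Type u} [∀ n, AddCommGroup (V n)] [∀ n, Module ℚ (V n)]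
variable {W : ℕ → Type v} [∀ n, AddCommGroup (W n)] [∀ n, Module ℚ (W n)]

/-- Morphisms of differential graded algebras between Sullivan algebras. -/
structure DGHom (A : SullivanAlgebra V) (B : SullivanAlgebra W) where
  toAlgHom : FreeCGA V →ₐ[ℚ] FreeCGA W
  map_degree : ∀ n, ∀ a ∈ degreePart V n, toAlgHom a ∈ degreePart W n
  map_d : ∀ a, toAlgHom (A.d a) = B.d (toAlgHom a)

/-- The map on cocycles induced by a morphism. -/
def DGHom.cocycleMap {A : SullivanAlgebra V} {B : SullivanAlgebra W} (f : DGHom A B) :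
    LinearMap.ker A.d →ₗ[ℚ] LinearMap.ker B.d :=
  f.toAlgHom.toLinearMap.restrict fun a ha => by
    rw [LinearMap.mem_ker] at ha ⊢
    rw [AlgHom.toLinearMap_apply, ← f.map_d, ha, map_zero]

/-- The map induced by a morphism in cohomology. -/
def DGHom.cohomologyMap {A : SullivanAlgebra V} {B : SullivanAlgebra W} (f : DGHom A B) :
    A.Cohomology →ₗ[ℚ] B.Cohomology :=
  Submodule.mapQ _ _ f.cocycleMap <| by
    rintro a ⟨b, hb⟩
    exact ⟨f.toAlgHom b, by rw [← f.map_d, hb]; rfl⟩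

/-- The graded vector space `⟨x_1, …, x_k⟩` with basis `x_i` of degree `deg i`. -/
abbrev GenSpace {k : ℕ} (deg : Fin k → ℕ) (n : ℕ) : Type := {i : Fin k // deg i = n} → ℚ

theorem GenSpace.subsingleton_zero {k : ℕ} {deg : Fin k → ℕ} (h : ∀ i, 0 < deg i) :
    Subsingleton (GenSpace deg 0) :=
  haveI : IsEmpty {i : Fin k // deg i = 0} := ⟨fun i => (h i.1).ne' i.2⟩
  inferInstance

/-- An isomorphism `(ΛV, d) ≅ (ΛW, d) ⊗ (Λ⟨x_1, …, x_k⟩, 0)` of commutative differential graded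
algebras. Since the tensor product is the coproduct of such algebras, a morphism out of it is
a pair of morphisms `f`, `g` out of the factors, which acts by `a ⊗ b ↦ f a * g b`. -/
structure Splitting (A : SullivanAlgebra V) (B : SullivanAlgebra W) {k : ℕ} (deg : Fin k → ℕ)
    (hdeg : ∀ i, 0 < deg i) where
  f : DGHom B A
  g : DGHom (zeroDiff (GenSpace deg) (GenSpace.subsingleton_zero hdeg)) A
  bijective : Function.Bijective
    (LinearMap.mul' ℚ (FreeCGA V) ∘ₗ
      TensorProduct.map f.toAlgHom.toLinearMap g.toAlgHom.toLinearMap)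

end Morphisms

end RHT

end

/-! Let m = dim V^even and n = dim V^odd. Purity turns ΛV into the Koszul complex of polynomials
f_0, …, f_{n-1} in m variables, the differentials of a basis of V^odd; the Koszul degree counts odd
generators. Upper degree and Koszul degree have the same parity, so H^even is the sum of the Koszul
homology groups H_0, H_2, H_4, …, and the question is whether those beyond H_0 vanish.

Finite-dimensional cohomology puts a power x_i^N of each variable into the ideal (f). These powers
form a regular sequence of length m, so H_i = 0 for i > n - m = χ_π (`RegularIn.kills_one`), and χ_π
≤ 1 leaves only H_0 among the even ones.

Conversely, n - m ≥ 2 forces H_2 ≠ 0 (`RegularIn.not_kills_one`). If H_2 vanished, rigidity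
(`Kills.exists_succ_degree`) would make every H_i with i ≥ 2 vanish near the origin. Dividing out
the x_i^N one at a time raises this bound by one each time, so H_n with coefficients in ℚ[x]/(x_i^N)
would vanish near the origin as well. But it contains the socle monomial ∏ x_i^(N-1), because the
f_j have no constant term. Multipliers r in 1 + m, with m now the ideal of the origin, take the
place of localisation.

For a splitting, passing to linear parts gives V ≅ V' ⊕ ⟨x_i⟩ with parities respected. The x_i are
odd, since no power of an even one would be a boundary; hence χ_π(ΛV) = k + χ_π(ΛV')
(`Splitting.homotopyEuler_eq`). The nonzero class in H_2(ΛV') survives in H(ΛV) because ΛV' is a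
retract (`Splitting.exists_d_eq`). Its image lies in the ideal generated by the odd generators
(`DGHom.comp_zero_map_eq_zero`), so it has no representative in ΛV^even. -/

noncomputable section

namespace RHT

universe u v w

/-! ### The Koszul complex of a sequence in a commutative ring -/

namespace Koszul

universe x

/-- The module underlying the Koszul complex of `n` elements of `R`, free of rank `2 ^ n`. -/
def Chain (R : Type x) : ℕ → Type x
  | 0 => R
  | n + 1 => Chain R n × Chain R n

variable {R : Type x} [CommRing R]

instance instAddCommGroupChain : ∀ n, AddCommGroup (Chain R n)
  | 0 => inferInstanceAs (AddCommGroup R)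
  | n + 1 =>
    letI := instAddCommGroupChain n
    inferInstanceAs (AddCommGroup (Chain R n × Chain R n))

instance instModuleChain : ∀ n, Module R (Chain R n)
  | 0 => inferInstanceAs (Module R R)
  | n + 1 =>
    letI := instModuleChain n
    inferInstanceAs (Module R (Chain R n × Chain R n))

instance instFiniteChain : ∀ n, Module.Finite R (Chain R n)
  | 0 => inferInstanceAs (Module.Finite R R)
  | n + 1 =>
    letI := instFiniteChain n
    inferInstanceAs (Module.Finite R (Chain R n × Chain R n))

/-- The differential of the Koszul complex. -/
def diff (f : ℕ → R) : ∀ n, Chain R n →ₗ[R] Chain R n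
  | 0 => 0
  | n + 1 =>
    -- A pair (a, b) stands for a + y_n b with y_n odd and d y_n = f_n; hence d(a + y_n b) = (d a +
    -- f_n b) - y_n d b.
    LinearMap.prod
      (diff f n ∘ₗ LinearMap.fst R (Chain R n) (Chain R n) +
        f n • LinearMap.snd R (Chain R n) (Chain R n))
      (-(diff f n ∘ₗ LinearMap.snd R (Chain R n) (Chain R n)))

/-- Multiplication by the element of degree one with coordinates `c`. -/
def lmul (c : ℕ → R) : ∀ n, Chain R n →ₗ[R] Chain R n
  | 0 => 0
  | n + 1 =>
    LinearMap.prod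
      (lmul c n ∘ₗ LinearMap.fst R (Chain R n) (Chain R n))
      (c n • LinearMap.fst R (Chain R n) (Chain R n) -
        lmul c n ∘ₗ LinearMap.snd R (Chain R n) (Chain R n))

/-- The component of degree `i` of the Koszul complex. -/
def deg : ∀ n : ℕ, ℕ → Submodule R (Chain R n)
  | 0, 0 => ⊤
  | 0, _ + 1 => ⊥
  | n + 1, 0 => (deg n 0).prod ⊥
  | n + 1, i + 1 => (deg n (i + 1)).prod (deg n i)

/-- The chains with coordinates in an ideal `J`. -/
def coordIn (J : Ideal R) : ∀ n : ℕ, Submodule R (Chain R n)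
  | 0 => J
  | n + 1 => (coordIn J n).prod (coordIn J n)

/-- The inclusion of `R` as the component of degree zero. -/
def bot : ∀ n : ℕ, R →ₗ[R] Chain R n
  | 0 => LinearMap.id
  | n + 1 => LinearMap.inl R (Chain R n) (Chain R n) ∘ₗ bot n

/-- The coordinate of degree zero. -/
def botCoord : ∀ n : ℕ, Chain R n →ₗ[R] R
  | 0 => LinearMap.id
  | n + 1 => botCoord n ∘ₗ LinearMap.fst R (Chain R n) (Chain R n)

/-- The inclusion of `R` as the component of degree `n`. -/
def top : ∀ n : ℕ, R →ₗ[R] Chain R n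
  | 0 => LinearMap.id
  | n + 1 => LinearMap.inr R (Chain R n) (Chain R n) ∘ₗ top n

variable {f c : ℕ → R} {n i : ℕ}

theorem diff_succ (z : Chain R (n + 1)) :
    diff f (n + 1) z = ((diff f n z.1 + f n • z.2, -diff f n z.2) : Chain R n × Chain R n) := rfl

theorem lmul_succ (z : Chain R (n + 1)) :
    lmul c (n + 1) z = ((lmul c n z.1, c n • z.1 - lmul c n z.2) : Chain R n × Chain R n) := rfl

theorem mem_deg_succ_zero {z : Chain R (n + 1)} :
    z ∈ deg (n + 1) 0 ↔ z.1 ∈ deg n 0 ∧ z.2 = 0 := Iff.rfl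

theorem diff_diff : ∀ (n : ℕ) (z : Chain R n), diff f n (diff f n z) = 0
  | 0, _ => rfl
  | n + 1, z => by
    rw [diff_succ, diff_succ]
    refine Prod.ext ?_ ?_
    · change diff f n (diff f n z.1 + f n • z.2) + f n • (-diff f n z.2) = 0
      rw [map_add, diff_diff n, map_smul, smul_neg]; abel
    · change -diff f n (-diff f n z.2) = 0
      rw [map_neg, diff_diff n]; simp

/-- Leibniz rule for η z, where η = ∑ c_j y_j. It makes every element dη of the ideal (f) act
null-homotopically. -/
theorem diff_lmul : ∀ (n : ℕ) (z : Chain R n),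
    diff f n (lmul c n z) + lmul c n (diff f n z) = (∑ j ∈ Finset.range n, c j * f j) • z
  | 0, z => by simp [diff, lmul]
  | n + 1, z => by
    rw [diff_succ, lmul_succ, lmul_succ, diff_succ, Finset.sum_range_succ]
    have h1 := diff_lmul n z.1
    have h2 := diff_lmul n z.2
    refine Prod.ext ?_ ?_
    · change diff f n (lmul c n z.1) + f n • (c n • z.1 - lmul c n z.2)
        + lmul c n (diff f n z.1 + f n • z.2) = (_ + _) • z.1
      rw [add_smul, ← h1, map_add, map_smul, mul_smul, smul_sub, smul_comm (c n)]; abel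
    · change -diff f n (c n • z.1 - lmul c n z.2)
        + (c n • (diff f n z.1 + f n • z.2) - lmul c n (-diff f n z.2)) = (_ + _) • z.2
      rw [add_smul, ← h2, map_sub, map_smul, map_neg, mul_smul, smul_add]; abel

theorem lmul_mem_deg : ∀ {n i : ℕ} {z : Chain R n}, z ∈ deg n i → lmul c n z ∈ deg n (i + 1)
  | 0, _, _, _ => rfl
  | n + 1, 0, z, hz =>
    ⟨lmul_mem_deg hz.1, Submodule.sub_mem _ (Submodule.smul_mem _ _ hz.1) (by
      change lmul c n z.2 ∈ _
      rw [(mem_deg_succ_zero.1 hz).2, map_zero]; exact zero_mem _)⟩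
  | n + 1, i + 1, z, hz =>
    ⟨lmul_mem_deg hz.1, Submodule.sub_mem _ (Submodule.smul_mem _ _ hz.1) (lmul_mem_deg hz.2)⟩

theorem diff_mem_deg : ∀ {n i : ℕ} {z : Chain R n}, z ∈ deg n (i + 1) → diff f n z ∈ deg n i
  | 0, _, _, _ => Submodule.zero_mem _
  | n + 1, 0, z, hz => by
    refine ⟨Submodule.add_mem _ (diff_mem_deg hz.1) (Submodule.smul_mem _ _ hz.2), ?_⟩
    -- A chain of degree 0 must have second coordinate exactly 0, so the vanishing of the
    -- differential in degree 0 is needed here.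
    have : ∀ {n : ℕ} {z : Chain R n}, z ∈ deg n 0 → diff f n z = 0 := by
      intro n
      induction n with
      | zero => intros; rfl
      | succ n ih =>
        intro z hz
        rw [diff_succ, ih hz.1, (mem_deg_succ_zero.1 hz).2]
        simp
        rfl
    change -diff f n z.2 = 0
    rw [this hz.2, neg_zero]
  | n + 1, i + 1, z, hz =>
    ⟨Submodule.add_mem _ (diff_mem_deg hz.1) (Submodule.smul_mem _ _ hz.2),
      Submodule.neg_mem _ (diff_mem_deg hz.2)⟩

theorem deg_eq_bot_of_lt : ∀ {n i : ℕ}, n < i → deg n i = (⊥ : Submodule R (Chain R n))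
  | 0, 0, h => absurd h (lt_irrefl _)
  | 0, _ + 1, _ => rfl
  | n + 1, 0, h => by omega
  | n + 1, i + 1, h => by
    change (deg n (i + 1)).prod (deg n i) = ⊥
    rw [deg_eq_bot_of_lt (by omega), deg_eq_bot_of_lt (by omega), Submodule.prod_bot]

/-- Chains with coordinates in J form a subcomplex. Computing modulo it replaces the Koszul complex
over R/J, so all quotients share one module of chains. -/
theorem diff_mem_coordIn {J : Ideal R} : ∀ {n : ℕ} {z : Chain R n},
    z ∈ coordIn J n → diff f n z ∈ coordIn J n
  | 0, _, _ => zero_mem _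
  | _ + 1, _, hz =>
    ⟨Submodule.add_mem _ (diff_mem_coordIn hz.1) (Submodule.smul_mem _ _ hz.2),
      Submodule.neg_mem _ (diff_mem_coordIn hz.2)⟩

theorem coordIn_bot : ∀ n : ℕ, coordIn (⊥ : Ideal R) n = ⊥
  | 0 => rfl
  | n + 1 => by
    change (coordIn ⊥ n).prod (coordIn ⊥ n) = ⊥
    rw [coordIn_bot n, Submodule.prod_bot]

theorem coordIn_mono {J J' : Ideal R} (h : J ≤ J') : ∀ {n : ℕ} {z : Chain R n},
    z ∈ coordIn J n → z ∈ coordIn J' n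
  | 0, _, hz => h hz
  | _ + 1, _, hz => ⟨coordIn_mono h hz.1, coordIn_mono h hz.2⟩

theorem smul_mem_coordIn {J : Ideal R} {g : R} (hg : g ∈ J) : ∀ {n : ℕ} (z : Chain R n),
    g • z ∈ coordIn J n
  | 0, z => J.mul_mem_right (show R from z) hg
  | _ + 1, z => ⟨smul_mem_coordIn hg z.1, smul_mem_coordIn hg z.2⟩

theorem mem_coordIn_of_smul_mem {J : Ideal R} {g : R} (hg : ∀ x, g * x ∈ J → x ∈ J) :
    ∀ {n : ℕ} {z : Chain R n}, g • z ∈ coordIn J n → z ∈ coordIn J n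
  | 0, z, hz => hg z hz
  | _ + 1, _, hz => ⟨mem_coordIn_of_smul_mem hg hz.1, mem_coordIn_of_smul_mem hg hz.2⟩

/-- Division by g modulo J, coordinate by coordinate. Keeping v in the same degree makes it usable
as the value of a connecting map. -/
theorem exists_of_mem_coordIn_sup {J : Ideal R} {g : R} : ∀ {n i : ℕ} {z : Chain R n},
    z ∈ deg n i → z ∈ coordIn (J ⊔ Ideal.span {g}) n → ∃ v ∈ deg n i, z - g • v ∈ coordIn J n
  | 0, 0, z, _, hz => by
    obtain ⟨u, hu, v, hv, h⟩ := Submodule.mem_sup.1 (show (show R from z) ∈ J ⊔ Ideal.span {g} from hz)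
    obtain ⟨v, rfl⟩ := Ideal.mem_span_singleton'.1 hv
    refine ⟨v, trivial, ?_⟩
    change (show R from z) - g * v ∈ J
    rw [← h]; simpa [mul_comm] using hu
  | 0, i + 1, z, h, hz => by
    rw [show z = 0 from h]
    exact ⟨0, rfl, by simp⟩
  | n + 1, 0, z, h, hz => by
    obtain ⟨v, hv, h1⟩ := exists_of_mem_coordIn_sup h.1 hz.1
    refine ⟨(v, 0), ⟨hv, rfl⟩, h1, ?_⟩
    change z.2 - g • (0 : Chain R n) ∈ _
    rw [(mem_deg_succ_zero.1 h).2]; simp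
  | n + 1, i + 1, z, h, hz => by
    obtain ⟨v, hv, h1⟩ := exists_of_mem_coordIn_sup h.1 hz.1
    obtain ⟨w, hw, h2⟩ := exists_of_mem_coordIn_sup h.2 hz.2
    exact ⟨(v, w), ⟨hv, hw⟩, h1, h2⟩

theorem bot_mem_deg : ∀ (n : ℕ) (p : R), bot n p ∈ deg n 0
  | 0, _ => trivial
  | n + 1, p => ⟨bot_mem_deg n p, rfl⟩

theorem botCoord_bot : ∀ (n : ℕ) (p : R), botCoord n (bot n p) = p
  | 0, _ => rfl
  | n + 1, p => botCoord_bot n p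

/-- Boundaries in degree 0 lie in the ideal (f). This later turns a primitive of x_i^N into an
expression of x_i^N through the f_j. -/
theorem botCoord_diff_mem : ∀ (n : ℕ) (z : Chain R n),
    ∃ c : ℕ → R, botCoord n (diff f n z) = ∑ j ∈ Finset.range n, c j * f j
  | 0, z => ⟨0, by simp [diff]⟩
  | n + 1, z => by
    obtain ⟨c, hc⟩ := botCoord_diff_mem n z.1
    refine ⟨Function.update c n (botCoord n z.2), ?_⟩
    change botCoord n (diff f n z.1 + f n • z.2) = _
    rw [map_add, hc, Finset.sum_range_succ, map_smul, Function.update_self, smul_eq_mul, mul_comm]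
    congr 1
    refine Finset.sum_congr rfl fun j hj => ?_
    rw [Function.update_of_ne (Finset.mem_range.1 hj).ne]

theorem top_mem_deg : ∀ (n : ℕ) (p : R), top n p ∈ deg n n
  | 0, _ => trivial
  | n + 1, p => ⟨zero_mem _, top_mem_deg n p⟩

theorem top_mem_coordIn_iff {J : Ideal R} {p : R} : ∀ {n : ℕ}, top n p ∈ coordIn J n ↔ p ∈ J
  | 0 => Iff.rfl
  | _ + 1 => ⟨fun h => top_mem_coordIn_iff.1 h.2, fun h => ⟨zero_mem _, top_mem_coordIn_iff.2 h⟩⟩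

/-- The boundary of p y_0 ⋯ y_{n-1} has coordinates ± f_j p and 0, so an element of R/J annihilated
by all f_j is a cycle of top degree. -/
theorem diff_top_mem_coordIn {J : Ideal R} {p : R} : ∀ {n : ℕ}, (∀ j < n, f j * p ∈ J) →
    diff f n (top n p) ∈ coordIn J n
  | 0, _ => zero_mem _
  | n + 1, h => by
    constructor
    · change diff f n 0 + f n • top n p ∈ _
      rw [map_zero, zero_add, ← map_smul]
      exact top_mem_coordIn_iff.2 (h n (Nat.lt_succ_self n))
    · exact Submodule.neg_mem _ (diff_top_mem_coordIn fun j hj => h j (by omega))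

/-- The multiple by `r` of every cycle of degree `i` of the Koszul complex modulo `J` is a
boundary. -/
def Kills (f : ℕ → R) (J : Ideal R) (n i : ℕ) (r : R) : Prop :=
  ∀ z ∈ deg n i, diff f n z ∈ coordIn J n → ∃ w ∈ deg n (i + 1), r • z - diff f n w ∈ coordIn J n

theorem kills_bot {r : R} : Kills f ⊥ n i r ↔
    ∀ z ∈ deg n i, diff f n z = 0 → ∃ w ∈ deg n (i + 1), r • z = diff f n w := by
  simp [Kills, coordIn_bot, sub_eq_zero]

/-- For g = dη and a cycle z modulo J, the chain η z is a cycle modulo J + (g). If r η z ≡ d w + g v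
modulo J, applying d gives g (r z - d v) ≡ 0, and g cancels. -/
theorem Kills.of_sup_span {J : Ideal R} {g r : R} (hreg : ∀ x, g * x ∈ J → x ∈ J)
    (hg : g = ∑ j ∈ Finset.range n, c j * f j)
    (h : Kills f (J ⊔ Ideal.span {g}) n (i + 1) r) : Kills f J n i r := by
  intro z hz hdz
  have e := diff_lmul (f := f) (c := c) n z
  rw [← hg] at e
  have lz := lmul_mem_deg (c := c) hz
  have key : ∀ {n : ℕ} {z : Chain R n}, z ∈ coordIn J n → lmul c n z ∈ coordIn J n := by
    intro n
    induction n with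
    | zero => intros; exact zero_mem _
    | succ n ih =>
      intro z hz
      exact ⟨ih hz.1, Submodule.sub_mem _ (Submodule.smul_mem _ _ hz.1) (ih hz.2)⟩
  have h1 : diff f n (lmul c n z) ∈ coordIn (J ⊔ Ideal.span {g}) n := by
    rw [eq_sub_of_add_eq e]
    exact Submodule.sub_mem _
      (smul_mem_coordIn (Ideal.mem_sup_right (Ideal.mem_span_singleton_self g)) z)
      (coordIn_mono le_sup_left (key hdz))
  obtain ⟨w, hw, hw'⟩ := h _ lz h1
  obtain ⟨v, hv, hv'⟩ := exists_of_mem_coordIn_sup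
    (Submodule.sub_mem _ (Submodule.smul_mem _ r lz) (diff_mem_deg hw)) hw'
  refine ⟨v, hv, mem_coordIn_of_smul_mem hreg ?_⟩
  have h2 := Submodule.add_mem _ (diff_mem_coordIn (f := f) hv') (Submodule.smul_mem _ r (key hdz))
  convert h2 using 1
  rw [map_sub, map_sub, diff_diff, map_smul, eq_sub_of_add_eq e, map_smul, smul_sub, smul_sub,
    smul_comm g r]
  abel

/-- The exact sequence H_{i+1}(R/J) → H_{i+1}(R/(J + g)) → H_i(R/J) coming from multiplication by g
on R/J; the annihilators of the outer terms multiply. -/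
theorem Kills.sup_span {J : Ideal R} {g r₁ r₂ : R} (hreg : ∀ x, g * x ∈ J → x ∈ J)
    (h₁ : Kills f J n (i + 1) r₁) (h₂ : Kills f J n i r₂) :
    Kills f (J ⊔ Ideal.span {g}) n (i + 1) (r₁ * r₂) := by
  intro z hz hdz
  obtain ⟨v, hv, hv'⟩ := exists_of_mem_coordIn_sup (diff_mem_deg hz) hdz
  have h3 : diff f n v ∈ coordIn J n := by
    refine mem_coordIn_of_smul_mem hreg ?_
    have := Submodule.neg_mem _ (diff_mem_coordIn (f := f) hv')
    rwa [map_sub, diff_diff, map_smul, zero_sub, neg_neg] at this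
  obtain ⟨w, hw, hw'⟩ := h₂ v hv h3
  obtain ⟨w', h4, h5⟩ := h₁ (r₂ • z - g • w)
    (Submodule.sub_mem _ (Submodule.smul_mem _ _ hz) (Submodule.smul_mem _ _ hw)) (by
      have := Submodule.add_mem _ (Submodule.smul_mem _ r₂ hv') (Submodule.smul_mem _ g hw')
      convert this using 1
      rw [map_sub, map_smul, map_smul, smul_sub, smul_sub, smul_comm g r₂]
      abel)
  refine ⟨w', h4, ?_⟩
  have := Submodule.add_mem _ (coordIn_mono (le_sup_left (b := Ideal.span {g})) h5)
    (smul_mem_coordIn (Ideal.mem_sup_right (S := J) (Ideal.mem_span_singleton_self g)) (r₁ • w))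
  convert this using 1
  rw [smul_sub, mul_smul, smul_comm g r₁]
  abel

/-- The complex on n + 1 elements is the cone of f_n on the complex on n elements. If r kills
H_{i+1} of the cone, then r H ⊆ f_n H for H = H_{i+1} of the smaller complex, so H = m H. Nakayama's
lemma for a finitely generated module provides r' in 1 + m killing H. -/
theorem Kills.exists_of_succ [IsNoetherianRing R] {m : Ideal R} (hf : f n ∈ m) {r : R}
    (hr : r - 1 ∈ m) (h : Kills f ⊥ (n + 1) (i + 1) r) :
    ∃ r', r' - 1 ∈ m ∧ Kills f ⊥ n (i + 1) r' := by
  set Z : Submodule R (Chain R n) := deg n (i + 1) ⊓ LinearMap.ker (diff f n) with hZ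
  set B : Submodule R (Chain R n) := (deg n (i + 2)).map (diff f n) with hB
  have : IsNoetherian R (Chain R n) := isNoetherian_of_isNoetherianRing_of_finite R _
  obtain ⟨r', h1, h2⟩ := Submodule.exists_sub_one_mem_and_smul_eq_zero_of_fg_of_le_smul m
    (Z.map B.mkQ) ((IsNoetherian.noetherian Z).map _) (by
      rw [← Submodule.map_smul'']
      rintro _ ⟨z, hz, rfl⟩
      obtain ⟨w, hw, e⟩ := kills_bot.1 h (z, 0) ⟨hz.1, zero_mem _⟩ (by
        refine Prod.ext ?_ ?_
        · change diff f n z + f n • (0 : Chain R n) = 0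
          rw [show diff f n z = 0 from hz.2, smul_zero, add_zero]
        · change -diff f n 0 = 0
          rw [map_zero, neg_zero])
      have e1 : r • z = diff f n w.1 + f n • w.2 := congrArg Prod.fst e
      have e2 : r • (0 : Chain R n) = -diff f n w.2 := congrArg Prod.snd e
      -- Since r z = d w.1 + f_n w.2 with w.2 a cycle, z agrees modulo boundaries with this element
      -- of m Z.
      refine ⟨f n • w.2 - (r - 1) • z, Submodule.sub_mem _ (Submodule.smul_mem_smul hf ⟨hw.2, ?_⟩)
        (Submodule.smul_mem_smul hr hz), ?_⟩
      · change diff f n w.2 = 0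
        rwa [smul_zero, eq_comm, neg_eq_zero] at e2
      · rw [← sub_eq_zero, ← map_sub, Submodule.mkQ_apply, Submodule.Quotient.mk_eq_zero]
        rw [show f n • w.2 - (r - 1) • z - z = diff f n (-w.1) by
          rw [map_neg, sub_smul, e1, one_smul]; abel]
        exact Submodule.mem_map_of_mem (Submodule.neg_mem _ hw.1))
  refine ⟨r', h1, kills_bot.2 fun z hz hdz => ?_⟩
  have := h2 _ (Submodule.mem_map_of_mem (f := B.mkQ) (show z ∈ Z from ⟨hz, hdz⟩))
  rw [← map_smul, Submodule.mkQ_apply, Submodule.Quotient.mk_eq_zero] at this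
  obtain ⟨w, hw, e⟩ := this
  exact ⟨w, hw, e.symm⟩

/-- The exact sequence H_{i+1}(K_n) → H_{i+1}(K_{n+1}) → H_i(K_n) of the cone of f_n. -/
theorem Kills.succ {r₁ r₂ : R} (h₁ : Kills f ⊥ n (i + 1) r₁) (h₂ : Kills f ⊥ n i r₂) :
    Kills f ⊥ (n + 1) (i + 1) (r₁ * r₂) := by
  rw [kills_bot] at *
  intro z hz hdz
  have e1 : diff f n z.1 + f n • z.2 = 0 := congrArg Prod.fst hdz
  have e2 : -diff f n z.2 = 0 := congrArg Prod.snd hdz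
  obtain ⟨w, hw, e3⟩ := h₂ z.2 hz.2 (by simpa using e2)
  obtain ⟨w', hw', e4⟩ := h₁ (r₂ • z.1 + f n • w)
    (Submodule.add_mem _ (Submodule.smul_mem _ _ hz.1) (Submodule.smul_mem _ _ hw)) (by
      rw [map_add, map_smul, map_smul, ← e3, smul_comm, ← smul_add, e1, smul_zero])
  refine ⟨(w', -(r₁ • w)), ⟨hw', Submodule.neg_mem _ (Submodule.smul_mem _ _ hw)⟩, ?_⟩
  refine Prod.ext ?_ ?_
  · change (r₁ * r₂) • z.1 = diff f n w' + f n • -(r₁ • w)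
    rw [← e4, smul_add, mul_smul, smul_neg, smul_comm (f n)]; abel
  · change (r₁ * r₂) • z.2 = - diff f n (-(r₁ • w))
    rw [map_neg, map_smul, ← e3, mul_smul, neg_neg]

theorem sub_one_mul_mem {m : Ideal R} {r₁ r₂ : R} (h₁ : r₁ - 1 ∈ m) (h₂ : r₂ - 1 ∈ m) :
    r₁ * r₂ - 1 ∈ m := by
  rw [show r₁ * r₂ - 1 = r₁ * (r₂ - 1) + (r₁ - 1) by ring]
  exact m.add_mem (m.mul_mem_left _ h₂) h₁

/-- Rigidity of the Koszul complex, up to elements of `1 + m`. -/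
theorem Kills.exists_succ_degree [IsNoetherianRing R] {m : Ideal R} :
    ∀ {n : ℕ}, (∀ j < n, f j ∈ m) →
    (∃ r, r - 1 ∈ m ∧ Kills f ⊥ n (i + 1) r) → ∃ r, r - 1 ∈ m ∧ Kills f ⊥ n (i + 2) r
  | 0, _, _ => ⟨1, by simp, kills_bot.2 fun z hz _ => ⟨0, rfl, by
      rw [show z = 0 from hz, smul_zero, map_zero]⟩⟩
  | n + 1, hf, ⟨r, hr, h⟩ => by
    -- Drop f_n by Nakayama, raise the degree by induction on the number of elements, then restore
    -- f_n with the cone sequence.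
    obtain ⟨r₂, h2, h2'⟩ := h.exists_of_succ (hf n (Nat.lt_succ_self n)) hr
    obtain ⟨r₁, h1, h1'⟩ := exists_succ_degree (fun j hj => hf j (by omega)) ⟨r₂, h2, h2'⟩
    exact ⟨_, sub_one_mul_mem h1 h2, h1'.succ h2'⟩

/-- A sequence `g 0, …, g (m - 1)` of elements of the ideal `(f 0, …, f (n - 1))` that is regular
modulo its predecessors. -/
structure RegularIn (f : ℕ → R) (n : ℕ) (g : ℕ → R) (m : ℕ) : Prop where
  regular : ∀ k < m, ∀ x, g k * x ∈ Ideal.span (g '' Set.Iio k) → x ∈ Ideal.span (g '' Set.Iio k)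
  mem : ∀ k < m, ∃ c : ℕ → R, g k = ∑ j ∈ Finset.range n, c j * f j

theorem span_image_Iio_succ (g : ℕ → R) (k : ℕ) :
    Ideal.span (g '' Set.Iio (k + 1)) = Ideal.span (g '' Set.Iio k) ⊔ Ideal.span {g k} := by
  rw [← Ideal.span_union, Set.union_singleton, ← Set.image_insert_eq]
  congr 2
  ext j; simp [le_iff_lt_or_eq, or_comm]

/-- Modulo all m elements g there are no nonzero chains in degrees above n. Removing one g at a time
lowers the vanishing bound by one, down to n - m over R itself. -/
theorem RegularIn.kills_one {g : ℕ → R} {m : ℕ} (H : RegularIn f n g m) {i : ℕ} (hi : n < i + m) :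
    Kills f ⊥ n i 1 := by
  have : ∀ j k i, j + k = m → n + k < i + m → Kills f (Ideal.span (g '' Set.Iio k)) n i 1 := by
    intro j
    induction j with
    | zero =>
      intro k i hk hi z hz _
      rw [deg_eq_bot_of_lt (by omega)] at hz
      rw [show z = 0 from hz]
      exact ⟨0, zero_mem _, by simp⟩
    | succ j ih =>
      intro k i hk hi
      obtain ⟨c, hc⟩ := H.mem k (by omega)
      refine Kills.of_sup_span (H.regular k (by omega)) hc ?_
      rw [← span_image_Iio_succ]
      exact ih (k + 1) (i + 1) (by omega) (by omega)
  simpa using this m 0 i (by omega) (by omega)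

/-- Rigidity spreads the vanishing of H_2 to all degrees from 2 on, up to multipliers in 1 + m.
Passing to R/(g_0, …, g_{k-1}) moves the bound to k + 2 ≤ n, which includes the top degree, where a
socle element t gives a cycle and there are no boundaries. -/
theorem RegularIn.not_kills_one [IsNoetherianRing R] {g : ℕ → R} {k : ℕ} (H : RegularIn f n g k)
    {m : Ideal R} (hf : ∀ j < n, f j ∈ m) {t : R} (ht : t ∉ Ideal.span (g '' Set.Iio k))
    (hmt : ∀ a ∈ m, a * t ∈ Ideal.span (g '' Set.Iio k)) (hn : k + 2 ≤ n) :
    ¬ Kills f ⊥ n 2 1 := by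
  intro h
  have h1 : ∀ i, ∃ r, r - 1 ∈ m ∧ Kills f ⊥ n (i + 2) r := by
    intro i
    induction i with
    | zero => exact ⟨1, by simp, h⟩
    | succ i ih => exact Kills.exists_succ_degree hf ih
  have h2 : ∀ l ≤ k, ∀ i, ∃ r, r - 1 ∈ m ∧
      Kills f (Ideal.span (g '' Set.Iio l)) n (i + 2 + l) r := by
    intro l
    induction l with
    | zero => intro _ i; simpa using h1 i
    | succ l ih =>
      intro hl i
      obtain ⟨r₁, e1, e1'⟩ := ih (by omega) (i + 1)
      obtain ⟨r₂, e2, e2'⟩ := ih (by omega) i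
      rw [span_image_Iio_succ]
      refine ⟨_, sub_one_mul_mem e1 e2, ?_⟩
      refine Kills.sup_span (i := i + 2 + l) (H.regular l (by omega)) ?_ e2'
      rwa [show i + 2 + l + 1 = i + 1 + 2 + l by ring]
  obtain ⟨r, hr, h3⟩ := h2 k le_rfl (n - 2 - k)
  rw [show n - 2 - k + 2 + k = n by omega] at h3
  obtain ⟨w, hw, h4⟩ := h3 (top n t) (top_mem_deg n t)
    (diff_top_mem_coordIn fun j hj => hmt _ (hf j hj))
  rw [deg_eq_bot_of_lt (Nat.lt_succ_self n)] at hw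
  rw [show w = 0 from hw, map_zero, sub_zero, ← map_smul, top_mem_coordIn_iff, smul_eq_mul] at h4
  apply ht
  -- Both r t and (r - 1) t lie in the ideal, hence so does t.
  have := Ideal.sub_mem _ h4 (hmt _ hr)
  rwa [show r * t - (r - 1) * t = t by ring] at this

end Koszul

/-! ### Powers of the variables of a polynomial ring -/

namespace Koszul

/-- The `N`-th powers of the variables, extended by zero. -/
def varPow (m N k : ℕ) : MvPolynomial (Fin m) ℚ :=
  if h : k < m then MvPolynomial.X ⟨k, h⟩ ^ N else 0

variable {m N : ℕ}

theorem mem_span_varPow {k : ℕ} (hk : k ≤ m) {x : MvPolynomial (Fin m) ℚ} :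
    x ∈ Ideal.span (varPow m N '' Set.Iio k) ↔ ∀ s ∈ x.support, ∃ j : Fin m, j.1 < k ∧ N ≤ s j := by
  have : varPow m N '' Set.Iio k = (fun s => MvPolynomial.monomial s (1 : ℚ)) ''
      {s | ∃ j : Fin m, j.1 < k ∧ s = Finsupp.single j N} := by
    ext y
    constructor
    · rintro ⟨j, hj, rfl⟩
      have hj' : j < k := hj
      exact ⟨_, ⟨⟨j, by omega⟩, hj, rfl⟩, by
        rw [varPow, dif_pos (by omega), MvPolynomial.X_pow_eq_monomial]⟩
    · rintro ⟨_, ⟨j, hj, rfl⟩, rfl⟩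
      exact ⟨j, hj, by simp [varPow, MvPolynomial.X_pow_eq_monomial]⟩
  rw [this, MvPolynomial.mem_ideal_span_monomial_image]
  refine forall₂_congr fun s _ => ⟨?_, ?_⟩
  · rintro ⟨_, ⟨j, hj, rfl⟩, h⟩
    exact ⟨j, hj, by simpa using h j⟩
  · rintro ⟨j, hj, h⟩
    exact ⟨_, ⟨j, hj, rfl⟩, by simpa using h⟩

/-- Multiplication by x_k^N does not change the exponents of the earlier variables, which alone
decide membership in the monomial ideal. -/
theorem varPow_regular {k : ℕ} (hk : k < m) (x : MvPolynomial (Fin m) ℚ)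
    (hx : varPow m N k * x ∈ Ideal.span (varPow m N '' Set.Iio k)) :
    x ∈ Ideal.span (varPow m N '' Set.Iio k) := by
  rw [mem_span_varPow hk.le] at *
  intro s hs
  rw [varPow, dif_pos hk, MvPolynomial.X_pow_eq_monomial] at hx
  obtain ⟨j, hj, h⟩ := hx (Finsupp.single ⟨k, hk⟩ N + s) (by
    rw [MvPolynomial.mem_support_iff, MvPolynomial.coeff_monomial_mul, one_mul]
    exact MvPolynomial.mem_support_iff.1 hs)
  refine ⟨j, hj, ?_⟩
  rwa [Finsupp.add_apply, Finsupp.single_eq_of_ne (by rintro rfl; exact lt_irrefl _ hj), zero_add] at h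

/-- The monomial ∏ x_i^(N-1) generates the socle of ℚ[x]/(x_i^N). Positivity of N keeps the
truncated exponent N - 1 below N. -/
theorem socle_not_mem (hN : 0 < N) :
    MvPolynomial.monomial (Finsupp.equivFunOnFinite.symm fun _ : Fin m => N - 1) (1 : ℚ) ∉
      Ideal.span (varPow m N '' Set.Iio m) := by
  rw [mem_span_varPow le_rfl]
  intro h
  obtain ⟨j, _, h⟩ := h _ (by
    rw [MvPolynomial.mem_support_iff, MvPolynomial.coeff_monomial, if_pos rfl]; exact one_ne_zero)
  simp at h
  omega

theorem mul_socle_mem {a : MvPolynomial (Fin m) ℚ}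
    (ha : a ∈ RingHom.ker (MvPolynomial.constantCoeff : MvPolynomial (Fin m) ℚ →+* ℚ)) :
    a * MvPolynomial.monomial (Finsupp.equivFunOnFinite.symm fun _ : Fin m => N - 1) (1 : ℚ) ∈
      Ideal.span (varPow m N '' Set.Iio m) := by
  rw [mem_span_varPow le_rfl]
  intro s hs
  rw [MvPolynomial.mem_support_iff, MvPolynomial.coeff_mul_monomial'] at hs
  split_ifs at hs with hle
  -- If every exponent stays below N, the monomial is the socle monomial itself and its coefficient
  -- is the constant term of a, which is zero.
  · by_contra! hcon
    apply hs
    rw [mul_one, show s - (Finsupp.equivFunOnFinite.symm fun _ : Fin m => N - 1) = 0 from ?_]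
    · exact ha
    · ext j
      have := hcon j j.2
      simp
      omega
  · exact absurd rfl hs

end Koszul

/-! ### Components with respect to an independent spanning family of subspaces -/

section Components

variable {M : Type u} [AddCommGroup M] [Module ℚ M] {p : ℕ → Submodule ℚ M}

/-- The `k`-th component map of an internal direct sum decomposition. -/
def comp (h : DirectSum.IsInternal p) (k : ℕ) : M →ₗ[ℚ] M :=
  (p k).subtype ∘ₗ DirectSum.component ℚ ℕ (fun i => p i) k ∘ₗ
    (LinearEquiv.ofBijective (DirectSum.coeLinearMap p) h).symm.toLinearMap

variable (h : DirectSum.IsInternal p)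

theorem comp_mem (k : ℕ) (a : M) : comp h k a ∈ p k := Subtype.coe_prop _

theorem equiv_symm_of_mem {k : ℕ} {a : M} (ha : a ∈ p k) :
    (LinearEquiv.ofBijective (DirectSum.coeLinearMap p) h).symm a =
      DirectSum.lof ℚ ℕ (fun i => p i) k ⟨a, ha⟩ := by
  rw [LinearEquiv.symm_apply_eq]
  exact (DirectSum.coeLinearMap_lof p k ⟨a, ha⟩).symm

theorem comp_of_mem {k : ℕ} {a : M} (ha : a ∈ p k) : comp h k a = a := by
  simp only [comp, LinearMap.comp_apply, LinearEquiv.coe_coe, equiv_symm_of_mem h ha]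
  rw [DirectSum.component.lof_self]; rfl

theorem comp_of_mem_ne {k l : ℕ} (hkl : l ≠ k) {a : M} (ha : a ∈ p k) : comp h l a = 0 := by
  simp only [comp, LinearMap.comp_apply, LinearEquiv.coe_coe, equiv_symm_of_mem h ha]
  rw [DirectSum.component.of, dif_neg hkl.symm]; rfl

theorem exists_sum_comp (a : M) : ∃ s : Finset ℕ, a = ∑ k ∈ s, comp h k a := by
  set x := (LinearEquiv.ofBijective (DirectSum.coeLinearMap p) h).symm a with hx
  classical
  refine ⟨DFinsupp.support x, ?_⟩
  have e : DirectSum.coeLinearMap p x = a :=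
    (LinearEquiv.ofBijective (DirectSum.coeLinearMap p) h).apply_symm_apply a
  conv_lhs => rw [← e]
  rw [DirectSum.coeLinearMap_eq_dfinsuppSum]
  rfl

theorem comp_induction (h : DirectSum.IsInternal p) {P : M → Prop} (hadd : ∀ a b, P a → P b → P (a + b))
    (hmem : ∀ k, ∀ a ∈ p k, P a) (a : M) : P a := by
  obtain ⟨s, hs⟩ := exists_sum_comp h a
  rw [hs]
  classical
  exact Finset.sum_induction _ P hadd (hmem 0 0 (zero_mem _)) fun k _ => hmem k _ (comp_mem h k a)

theorem comp_eq_zero_of_mem_iSup {Q : ℕ → Prop} {a : M} (ha : a ∈ ⨆ k, ⨆ _ : Q k, p k) {l : ℕ}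
    (hl : ¬ Q l) : comp h l a = 0 := by
  have : (⨆ k, ⨆ _ : Q k, p k) ≤ LinearMap.ker (comp h l) :=
    iSup₂_le fun k hk b hb => comp_of_mem_ne h (by rintro rfl; exact hl hk) hb
  exact this ha

/-- A map that shifts degrees commutes with the components. -/
theorem comp_map {d : M →ₗ[ℚ] M} {k l : ℕ} (hkl : ∀ a ∈ p k, d a ∈ p l)
    (hne : ∀ j, j ≠ k → ∀ a ∈ p j, comp h l (d a) = 0) (a : M) : comp h l (d a) = d (comp h k a) := by
  refine comp_induction h (P := fun a => comp h l (d a) = d (comp h k a)) ?_ ?_ a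
  · intro a b ha hb; simp only [map_add, ha, hb]
  · intro j a ha
    by_cases hj : j = k
    · subst hj; rw [comp_of_mem h ha, comp_of_mem h (hkl a ha)]
    · rw [hne j hj a ha, comp_of_mem_ne h (Ne.symm hj) ha, map_zero]

/-- The 2^k are distinct eigenvalues of a single endomorphism, so independence is automatic. This
serves both gradings of ΛV. -/
theorem isInternal_of_eigen (φ : Module.End ℚ M) (hφ : ∀ k, ∀ a ∈ p k, φ a = (2 : ℚ) ^ k • a)
    (htop : ⨆ k, p k = ⊤) : DirectSum.IsInternal p := by
  rw [DirectSum.isInternal_submodule_iff_iSupIndep_and_iSup_eq_top]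
  refine ⟨?_, htop⟩
  have h1 := (Module.End.eigenspaces_iSupIndep φ).comp (f := fun k : ℕ => (2 : ℚ) ^ k)
    (pow_right_injective₀ (by norm_num) (by norm_num))
  exact h1.mono fun k a ha => Module.End.mem_eigenspace_iff.2 (hφ k a ha)

end Components

/-! ### The free commutative graded algebra -/

section FreeAlgebra

variable (V : ℕ → Type u) [∀ n, AddCommGroup (V n)] [∀ n, Module ℚ (V n)]

theorem oddIncl_mul_evenIncl (a : ExteriorAlgebra ℚ (OddPart V))
    (p : SymmetricAlgebra ℚ (EvenPart V)) :
    oddIncl V a * evenIncl V p = (a ⊗ₜ[ℚ] p : ExteriorAlgebra ℚ (OddPart V) ⊗[ℚ] SymmetricAlgebra ℚ (EvenPart V)) := by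
  refine (Algebra.TensorProduct.tmul_mul_tmul a 1 1 p).trans ?_
  rw [mul_one, one_mul]

theorem evenIncl_mul_oddIncl (a : ExteriorAlgebra ℚ (OddPart V))
    (p : SymmetricAlgebra ℚ (EvenPart V)) :
    evenIncl V p * oddIncl V a = oddIncl V a * evenIncl V p := by
  rw [oddIncl_mul_evenIncl]
  refine (Algebra.TensorProduct.tmul_mul_tmul 1 a p 1).trans ?_
  rw [mul_one, one_mul]

variable {V}

theorem FreeCGA.tensor_induction {P : FreeCGA V → Prop} (hadd : ∀ a b, P a → P b → P (a + b))
    (hmul : ∀ a p, P (oddIncl V a * evenIncl V p)) (x : FreeCGA V) : P x := by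
  refine TensorProduct.induction_on (motive := P) x ?_ ?_ hadd
  · have := hmul 0 0
    rwa [map_zero, zero_mul] at this
  · intro a p; rw [← oddIncl_mul_evenIncl]; exact hmul a p

theorem evenIncl_comm (p : SymmetricAlgebra ℚ (EvenPart V)) (x : FreeCGA V) :
    evenIncl V p * x = x * evenIncl V p := by
  refine FreeCGA.tensor_induction (P := fun x => evenIncl V p * x = x * evenIncl V p) ?_ ?_ x
  · intro a b ha hb; rw [mul_add, add_mul, ha, hb]
  · intro a q
    rw [← mul_assoc, evenIncl_mul_oddIncl, mul_assoc, mul_assoc, ← map_mul, ← map_mul, mul_comm p]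

theorem gen_of_even {n : ℕ} (h : Even n) (x : V n) : gen V n x =
    evenIncl V (SymmetricAlgebra.ι ℚ (EvenPart V)
      (DirectSum.lof ℚ {n : ℕ // Even n} (fun m => V m.1) ⟨n, h⟩ x)) := by
  rw [gen, dif_pos h]; rfl

theorem gen_of_odd {n : ℕ} (h : ¬ Even n) (x : V n) : gen V n x =
    oddIncl V (ExteriorAlgebra.ι ℚ
      (DirectSum.lof ℚ {n : ℕ // ¬ Even n} (fun m => V m.1) ⟨n, h⟩ x)) := by
  rw [gen, dif_neg h]; rfl

theorem gen_mul_gen (m n : ℕ) (x : V m) (y : V n) :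
    gen V m x * gen V n y = (-1 : ℚ) ^ (m * n) • (gen V n y * gen V m x) := by
  by_cases hm : Even m
  · rw [gen_of_even hm, evenIncl_comm, (hm.mul_right n).neg_one_pow, one_smul]
  by_cases hn : Even n
  · rw [gen_of_even hn, evenIncl_comm, (hn.mul_left m).neg_one_pow, one_smul]
  rw [gen_of_odd hm, gen_of_odd hn, ← map_mul (oddIncl V), ← map_mul (oddIncl V)]
  rw [Nat.not_even_iff_odd] at hm hn
  rw [(hm.mul hn).neg_one_pow, neg_one_smul, ← map_neg]
  congr 1
  rw [eq_neg_iff_add_eq_zero]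
  exact ExteriorAlgebra.ι_add_mul_swap _ _

/-- The product of a list of generators. -/
def listProd (l : List (Σ n, V n)) : FreeCGA V := (l.map fun x => gen V x.1 x.2).prod

/-- The sum of the degrees of a list of generators. -/
def listDeg (l : List (Σ n, V n)) : ℕ := (l.map Sigma.fst).sum

theorem listProd_append (l l' : List (Σ n, V n)) :
    listProd (l ++ l') = listProd l * listProd l' := by
  simp [listProd]

omit [∀ n, AddCommGroup (V n)] [∀ n, Module ℚ (V n)] in
theorem listDeg_append (l l' : List (Σ n, V n)) :
    listDeg (l ++ l') = listDeg l + listDeg l' := by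
  simp [listDeg]

theorem listProd_cons (x : Σ n, V n) (l : List (Σ n, V n)) :
    listProd (x :: l) = gen V x.1 x.2 * listProd l := by
  simp [listProd]

omit [∀ n, AddCommGroup (V n)] [∀ n, Module ℚ (V n)] in
theorem listDeg_cons (x : Σ n, V n) (l : List (Σ n, V n)) :
    listDeg (x :: l) = x.1 + listDeg l := by
  simp [listDeg]

variable (V) in
/-- The span of the products of generators whose total degree satisfies `P`. -/
def degreeSpan (P : ℕ → Prop) : Submodule ℚ (FreeCGA V) :=
  Submodule.span ℚ {a | ∃ l : List (Σ n, V n), P (listDeg l) ∧ listProd l = a}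

theorem degreePart_eq (m : ℕ) : degreePart V m = degreeSpan V (· = m) := rfl

theorem listProd_mem {P : ℕ → Prop} {l : List (Σ n, V n)} (h : P (listDeg l)) :
    listProd l ∈ degreeSpan V P := Submodule.subset_span ⟨l, h, rfl⟩

theorem gen_mem_degreeSpan {P : ℕ → Prop} {n : ℕ} (h : P n) (x : V n) :
    gen V n x ∈ degreeSpan V P := by
  have := listProd_mem (P := P) (l := [⟨n, x⟩]) (by simpa [listDeg] using h)
  simpa [listProd] using this

theorem gen_mem_degreePart (n : ℕ) (x : V n) : gen V n x ∈ degreePart V n :=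
  gen_mem_degreeSpan (P := (· = n)) rfl x

theorem one_mem_degreeSpan {P : ℕ → Prop} (h : P 0) : (1 : FreeCGA V) ∈ degreeSpan V P :=
  listProd_mem (P := P) (l := []) h

theorem mul_mem_degreeSpan {P Q R : ℕ → Prop} (h : ∀ a b, P a → Q b → R (a + b)) {a b : FreeCGA V}
    (ha : a ∈ degreeSpan V P) (hb : b ∈ degreeSpan V Q) : a * b ∈ degreeSpan V R := by
  have := Submodule.mul_mem_mul ha hb
  rw [degreeSpan, degreeSpan, Submodule.span_mul_span] at this
  refine Submodule.span_le.2 ?_ this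
  rintro _ ⟨_, ⟨l, hl, rfl⟩, _, ⟨l', hl', rfl⟩, rfl⟩
  change listProd l * listProd l' ∈ _
  rw [← listProd_append]
  exact listProd_mem (by rw [listDeg_append]; exact h _ _ hl hl')

theorem mul_mem_degreePart {m n : ℕ} {a b : FreeCGA V} (ha : a ∈ degreePart V m)
    (hb : b ∈ degreePart V n) : a * b ∈ degreePart V (m + n) :=
  mul_mem_degreeSpan (P := (· = m)) (Q := (· = n)) (R := (· = m + n))
    (by rintro _ _ rfl rfl; rfl) ha hb

theorem degreeSpan_le_iSup (P : ℕ → Prop) :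
    degreeSpan V P ≤ ⨆ n, ⨆ _ : P n, degreePart V n := by
  refine Submodule.span_le.2 ?_
  rintro _ ⟨l, hl, rfl⟩
  exact Submodule.mem_iSup_of_mem _ (Submodule.mem_iSup_of_mem hl
    (listProd_mem (P := (· = listDeg l)) rfl))

theorem degreeSpan_induction {P : ℕ → Prop} {Q : FreeCGA V → Prop}
    (hzero : Q 0) (hadd : ∀ a b, Q a → Q b → Q (a + b)) (hsmul : ∀ (c : ℚ) a, Q a → Q (c • a))
    (hlist : ∀ l : List (Σ n, V n), P (listDeg l) → Q (listProd l)) {a : FreeCGA V}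
    (ha : a ∈ degreeSpan V P) : Q a := by
  induction ha using Submodule.span_induction with
  | mem x h => obtain ⟨l, hl, rfl⟩ := h; exact hlist l hl
  | zero => exact hzero
  | add x y _ _ hx hy => exact hadd _ _ hx hy
  | smul c x _ hx => exact hsmul _ _ hx

variable (V) in
/-- The subalgebra of `ΛV` formed by the elements of even degree. -/
def evenDegree : Subalgebra ℚ (FreeCGA V) :=
  (degreeSpan V Even).toSubalgebra (one_mem_degreeSpan (by simp)) fun _ _ ha hb =>
    mul_mem_degreeSpan (fun _ _ => Even.add) ha hb

theorem evenIncl_mem_degreeSpan (p : SymmetricAlgebra ℚ (EvenPart V)) :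
    evenIncl V p ∈ degreeSpan V Even := by
  change evenIncl V p ∈ evenDegree V
  induction p using SymmetricAlgebra.induction with
  | algebraMap r => rw [AlgHom.commutes]; exact Subalgebra.algebraMap_mem _ r
  | ι x =>
    induction x using DirectSum.induction_on with
    | zero => rw [map_zero, map_zero]; exact zero_mem _
    | of i x =>
      have := gen_mem_degreeSpan (P := Even) i.2 x
      rw [gen_of_even i.2] at this
      exact this
    | add x y hx hy => rw [map_add, map_add]; exact add_mem hx hy
  | mul a b ha hb => rw [map_mul]; exact mul_mem ha hb
  | add a b ha hb => rw [map_add]; exact add_mem ha hb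

theorem oddIncl_ι_mem_degreeSpan (x : OddPart V) :
    oddIncl V (ExteriorAlgebra.ι ℚ x) ∈ degreeSpan V (fun n => ¬ Even n) := by
  induction x using DirectSum.induction_on with
  | zero => rw [map_zero, map_zero]; exact zero_mem _
  | of i x =>
    have := gen_mem_degreeSpan (P := fun n => ¬ Even n) i.2 x
    rw [gen_of_odd i.2] at this
    exact this
  | add x y hx hy => rw [map_add, map_add]; exact add_mem hx hy

theorem degreeSpan_true : degreeSpan V (fun _ => True) = ⊤ := by
  rw [eq_top_iff]
  rintro x -
  refine FreeCGA.tensor_induction (P := (· ∈ degreeSpan V (fun _ => True)))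
    (fun _ _ => add_mem) ?_ x
  intro a p
  have hmono : ∀ P : ℕ → Prop, degreeSpan V P ≤ degreeSpan V (fun _ => True) := fun P =>
    Submodule.span_mono (by rintro _ ⟨l, _, rfl⟩; exact ⟨l, trivial, rfl⟩)
  have hmul : ∀ {a b : FreeCGA V}, a ∈ degreeSpan V (fun _ => True) →
      b ∈ degreeSpan V (fun _ => True) → a * b ∈ degreeSpan V (fun _ => True) := fun ha hb =>
    mul_mem_degreeSpan (fun _ _ _ _ => trivial) ha hb
  refine hmul ?_ (hmono _ (evenIncl_mem_degreeSpan p))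
  induction a using ExteriorAlgebra.induction with
  | algebraMap r =>
    rw [AlgHom.commutes, Algebra.algebraMap_eq_smul_one]
    exact Submodule.smul_mem _ _ (one_mem_degreeSpan trivial)
  | ι x => exact hmono _ (oddIncl_ι_mem_degreeSpan x)
  | mul a b ha hb => rw [map_mul]; exact hmul ha hb
  | add a b ha hb => rw [map_add]; exact add_mem ha hb

theorem FreeCGA.list_induction {Q : FreeCGA V → Prop}
    (hadd : ∀ a b, Q a → Q b → Q (a + b)) (hsmul : ∀ (c : ℚ) a, Q a → Q (c • a))
    (hlist : ∀ l : List (Σ n, V n), Q (listProd l)) (a : FreeCGA V) : Q a := by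
  have : a ∈ degreeSpan V (fun _ => True) := by rw [degreeSpan_true]; trivial
  exact degreeSpan_induction (by simpa using hsmul 0 _ (hlist [])) hadd hsmul (fun l _ => hlist l) this

theorem FreeCGA.algHom_ext {B : Type v} [Ring B] [Algebra ℚ B] {f g : FreeCGA V →ₐ[ℚ] B}
    (h : ∀ n x, f (gen V n x) = g (gen V n x)) : f = g := by
  ext a
  refine FreeCGA.list_induction (Q := fun a => f a = g a) ?_ ?_ ?_ a
  · intro a b ha hb; rw [map_add, map_add, ha, hb]
  · intro c a ha; rw [map_smul, map_smul, ha]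
  · intro l
    simp only [listProd, map_list_prod, List.map_map]
    congr 2
    ext x; exact h _ _

/-- The endomorphism of `ΛV` that extends endomorphisms of `V^odd` and `V^even`. -/
def endo (o : OddPart V →ₗ[ℚ] OddPart V) (e : EvenPart V →ₗ[ℚ] EvenPart V) :
    FreeCGA V →ₐ[ℚ] FreeCGA V :=
  (Algebra.TensorProduct.map (ExteriorAlgebra.map o)
    (SymmetricAlgebra.lift (SymmetricAlgebra.ι ℚ (EvenPart V) ∘ₗ e)) :
    ExteriorAlgebra ℚ (OddPart V) ⊗[ℚ] SymmetricAlgebra ℚ (EvenPart V) →ₐ[ℚ]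
      ExteriorAlgebra ℚ (OddPart V) ⊗[ℚ] SymmetricAlgebra ℚ (EvenPart V))

theorem endo_oddIncl (o : OddPart V →ₗ[ℚ] OddPart V) (e : EvenPart V →ₗ[ℚ] EvenPart V)
    (a : ExteriorAlgebra ℚ (OddPart V)) :
    endo o e (oddIncl V a) = oddIncl V (ExteriorAlgebra.map o a) := by
  change Algebra.TensorProduct.map _ _ (a ⊗ₜ[ℚ] 1) = _
  rw [Algebra.TensorProduct.map_tmul, map_one]; rfl

theorem endo_evenIncl (o : OddPart V →ₗ[ℚ] OddPart V) (e : EvenPart V →ₗ[ℚ] EvenPart V)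
    (p : SymmetricAlgebra ℚ (EvenPart V)) : endo o e (evenIncl V p) =
      evenIncl V (SymmetricAlgebra.lift (SymmetricAlgebra.ι ℚ (EvenPart V) ∘ₗ e) p) := by
  change Algebra.TensorProduct.map _ _ (1 ⊗ₜ[ℚ] p) = _
  rw [Algebra.TensorProduct.map_tmul, map_one]; rfl

/-- The pieces are separated by the algebra endomorphism that multiplies V^n by 2^n. -/
theorem isInternal_degreePart : DirectSum.IsInternal (degreePart V) := by
  refine isInternal_of_eigen (endo (DirectSum.lmap fun n => (2 : ℚ) ^ n.1 • LinearMap.id)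
    (DirectSum.lmap fun n => (2 : ℚ) ^ n.1 • LinearMap.id)).toLinearMap ?_ ?_
  · have hgen : ∀ n (x : V n), endo (DirectSum.lmap fun n => (2 : ℚ) ^ n.1 • LinearMap.id)
        (DirectSum.lmap fun n => (2 : ℚ) ^ n.1 • LinearMap.id) (gen V n x)
        = (2 : ℚ) ^ n • gen V n x := by
      intro n x
      by_cases hn : Even n
      · rw [gen_of_even hn, endo_evenIncl, SymmetricAlgebra.lift_ι_apply, LinearMap.comp_apply,
          DirectSum.lmap_lof]
        simp only [LinearMap.smul_apply, LinearMap.id_apply, map_smul]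
      · rw [gen_of_odd hn, endo_oddIncl, ExteriorAlgebra.map_apply_ι, DirectSum.lmap_lof]
        simp only [LinearMap.smul_apply, LinearMap.id_apply, map_smul]
    intro k a ha
    rw [degreePart_eq] at ha
    induction ha using Submodule.span_induction with
    | zero => simp
    | add x y _ _ hx hy => rw [map_add, hx, hy, smul_add]
    | smul c x _ hx => rw [map_smul, hx, smul_comm]
    | mem x h =>
      obtain ⟨l, rfl, rfl⟩ := h
      rw [AlgHom.toLinearMap_apply]
      induction l with
      | nil => simp [listProd, listDeg]
      | cons x l ih =>
        rw [listProd_cons, map_mul, ih, hgen, listDeg_cons, pow_add, smul_mul_smul_comm]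
  · rw [eq_top_iff, ← degreeSpan_true]
    refine (degreeSpan_le_iSup _).trans ?_
    exact iSup_mono fun n => iSup_le fun _ => le_rfl

theorem mem_lowerPart_of_mul {i : ℕ} {a : ExteriorAlgebra ℚ (OddPart V)}
    (ha : a ∈ ⋀[ℚ]^i (OddPart V)) (p : SymmetricAlgebra ℚ (EvenPart V)) :
    oddIncl V a * evenIncl V p ∈ lowerPart V i :=
  Submodule.mul_mem_mul (Submodule.mem_map_of_mem ha) ⟨p, rfl⟩

theorem lowerPart_induction {i : ℕ} {Q : FreeCGA V → Prop} (hadd : ∀ a b, Q a → Q b → Q (a + b))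
    (hmul : ∀ a ∈ ⋀[ℚ]^i (OddPart V), ∀ p, Q (oddIncl V a * evenIncl V p)) {x : FreeCGA V}
    (hx : x ∈ lowerPart V i) : Q x := by
  refine Submodule.mul_induction_on hx ?_ hadd
  rintro _ ⟨a, ha, rfl⟩ _ ⟨p, rfl⟩
  exact hmul a ha p

theorem mul_mem_lowerPart {i j : ℕ} {a b : FreeCGA V} (ha : a ∈ lowerPart V i)
    (hb : b ∈ lowerPart V j) : a * b ∈ lowerPart V (i + j) := by
  refine lowerPart_induction (Q := fun a => a * b ∈ lowerPart V (i + j)) ?_ ?_ ha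
  · intro a b ha hb; rw [add_mul]; exact add_mem ha hb
  intro a ha p
  refine lowerPart_induction (Q := fun b => _ * b ∈ lowerPart V (i + j)) ?_ ?_ hb
  · intro a b ha hb; rw [mul_add]; exact add_mem ha hb
  intro b hb q
  rw [mul_assoc, ← mul_assoc (evenIncl V p), evenIncl_mul_oddIncl, mul_assoc, ← mul_assoc,
    ← map_mul, ← map_mul]
  refine mem_lowerPart_of_mul ?_ _
  rw [ExteriorAlgebra.exteriorPower, pow_add]
  exact Submodule.mul_mem_mul ha hb

theorem evenIncl_mem_lowerPart (p : SymmetricAlgebra ℚ (EvenPart V)) :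
    evenIncl V p ∈ lowerPart V 0 := by
  have := mem_lowerPart_of_mul (V := V) (i := 0) (a := 1) (by simp [ExteriorAlgebra.exteriorPower]) p
  simpa using this

theorem mem_lowerPart_zero {x : FreeCGA V} : x ∈ lowerPart V 0 ↔ ∃ p, evenIncl V p = x := by
  refine ⟨fun hx => ?_, by rintro ⟨p, rfl⟩; exact evenIncl_mem_lowerPart p⟩
  refine lowerPart_induction (Q := fun x => ∃ p, evenIncl V p = x) ?_ ?_ hx
  · rintro _ _ ⟨p, rfl⟩ ⟨q, rfl⟩; exact ⟨p + q, map_add _ _ _⟩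
  intro a ha p
  rw [ExteriorAlgebra.exteriorPower, pow_zero, Submodule.mem_one] at ha
  obtain ⟨r, rfl⟩ := ha
  exact ⟨r • p, by rw [AlgHom.commutes, map_smul, Algebra.smul_def]⟩

theorem oddIncl_ι_mem_lowerPart (x : OddPart V) :
    oddIncl V (ExteriorAlgebra.ι ℚ x) ∈ lowerPart V 1 := by
  have := mem_lowerPart_of_mul (V := V) (i := 1) (a := ExteriorAlgebra.ι ℚ x)
    (by rw [ExteriorAlgebra.exteriorPower, pow_one]; exact LinearMap.mem_range_self _ _) 1
  simpa using this

/-- The lower degree counts the odd factors, whose number has the parity of the total degree. This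
link between the two gradings reduces H^even to even Koszul degrees. -/
theorem listProd_mem_lowerPart (l : List (Σ n, V n)) :
    ∃ i, (Even i ↔ Even (listDeg l)) ∧ listProd l ∈ lowerPart V i := by
  induction l with
  | nil => exact ⟨0, by simp [listDeg], mem_lowerPart_zero.2 ⟨1, map_one _⟩⟩
  | cons x l ih =>
    obtain ⟨i, hi, h⟩ := ih
    rw [listProd_cons, listDeg_cons]
    by_cases hx : Even x.1
    · exact ⟨0 + i, by rw [zero_add, hi, Nat.even_add]; tauto, mul_mem_lowerPart
        (by rw [gen_of_even hx]; exact evenIncl_mem_lowerPart _) h⟩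
    · exact ⟨1 + i, by rw [Nat.even_add, hi, Nat.even_add]; simp [hx], mul_mem_lowerPart
        (by rw [gen_of_odd hx]; exact oddIncl_ι_mem_lowerPart _) h⟩

theorem degreeSpan_even_le : degreeSpan V Even ≤ ⨆ i, ⨆ _ : Even i, lowerPart V i := by
  refine Submodule.span_le.2 ?_
  rintro _ ⟨l, hl, rfl⟩
  obtain ⟨i, hi, h⟩ := listProd_mem_lowerPart l
  exact Submodule.mem_iSup_of_mem _ (Submodule.mem_iSup_of_mem (hi.2 hl) h)

theorem degreeSpan_odd_le :
    degreeSpan V (fun n => ¬ Even n) ≤ ⨆ i, ⨆ _ : ¬ Even i, lowerPart V i := by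
  refine Submodule.span_le.2 ?_
  rintro _ ⟨l, hl, rfl⟩
  obtain ⟨i, hi, h⟩ := listProd_mem_lowerPart l
  exact Submodule.mem_iSup_of_mem _ (Submodule.mem_iSup_of_mem (fun h => hl (hi.1 h)) h)

/-- The pieces are separated by the endomorphism that doubles the odd generators and fixes the even
ones. -/
theorem isInternal_lowerPart : DirectSum.IsInternal (lowerPart V) := by
  refine isInternal_of_eigen (endo ((2 : ℚ) • LinearMap.id) LinearMap.id).toLinearMap ?_ ?_
  · intro k y hy
    refine lowerPart_induction (Q := fun a => endo _ _ a = (2 : ℚ) ^ k • a) ?_ ?_ hy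
    · intro a b ha hb; rw [map_add, ha, hb, smul_add]
    clear hy
    intro a ha p
    rw [map_mul, endo_oddIncl, endo_evenIncl, LinearMap.comp_id, SymmetricAlgebra.lift_ι,
      AlgHom.id_apply, ← smul_mul_assoc, ← map_smul]
    congr 2
    rw [ExteriorAlgebra.exteriorPower] at ha
    induction ha using Submodule.pow_induction_on_left' with
    | algebraMap r => rw [AlgHom.commutes, pow_zero, one_smul]
    | add x y i _ _ hx hy => rw [map_add, hx, hy, smul_add]
    | mem_mul m hm i x _ hx =>
      obtain ⟨v, rfl⟩ := hm
      rw [map_mul, hx, ExteriorAlgebra.map_apply_ι, LinearMap.smul_apply, LinearMap.id_apply,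
        map_smul, smul_mul_smul_comm, pow_succ']
  · rw [eq_top_iff]
    rintro x -
    refine FreeCGA.list_induction (Q := (· ∈ ⨆ i, lowerPart V i)) (fun _ _ => add_mem)
      (fun c _ => Submodule.smul_mem _ c) ?_ x
    intro l
    obtain ⟨i, _, h⟩ := listProd_mem_lowerPart l
    exact Submodule.mem_iSup_of_mem i h

theorem lowerPart_two_le : lowerPart V 2 ≤ degreeSpan V Even := by
  intro x hx
  refine lowerPart_induction (Q := (· ∈ degreeSpan V Even)) (fun _ _ => add_mem) ?_ hx
  intro a ha p
  refine mul_mem_degreeSpan (fun _ _ => Even.add) ?_ (evenIncl_mem_degreeSpan p)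
  rw [ExteriorAlgebra.exteriorPower, pow_two] at ha
  refine Submodule.mul_induction_on (C := fun a => oddIncl V a ∈ degreeSpan V Even) ha ?_ ?_
  · rintro _ ⟨v, rfl⟩ _ ⟨w, rfl⟩
    rw [map_mul]
    refine mul_mem_degreeSpan (fun a b ha hb => ?_) (oddIncl_ι_mem_degreeSpan v)
      (oddIncl_ι_mem_degreeSpan w)
    rw [Nat.even_add]; tauto
  · intro a b ha hb; rw [map_add]; exact add_mem ha hb

theorem gen_mul_listProd (n : ℕ) (x : V n) (l : List (Σ n, V n)) :
    gen V n x * listProd l = (-1 : ℚ) ^ (n * listDeg l) • (listProd l * gen V n x) := by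
  induction l with
  | nil => simp [listProd, listDeg]
  | cons y l ih =>
    rw [listProd_cons, ← mul_assoc, gen_mul_gen, smul_mul_assoc, mul_assoc, ih, mul_smul_comm,
      smul_smul, listDeg_cons, mul_add, pow_add, mul_assoc]

theorem listProd_comm (l l' : List (Σ n, V n)) :
    listProd l * listProd l' =
      (-1 : ℚ) ^ (listDeg l * listDeg l') • (listProd l' * listProd l) := by
  induction l with
  | nil => simp [listProd, listDeg]
  | cons y l ih =>
    rw [listProd_cons, mul_assoc, ih, mul_smul_comm, ← mul_assoc, gen_mul_listProd, smul_mul_assoc,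
      smul_smul, listDeg_cons, add_mul, pow_add, mul_assoc, mul_comm ((-1 : ℚ) ^ _)]

theorem degreePart_comm {m n : ℕ} {a b : FreeCGA V} (ha : a ∈ degreePart V m)
    (hb : b ∈ degreePart V n) : a * b = (-1 : ℚ) ^ (m * n) • (b * a) := by
  rw [degreePart_eq] at ha hb
  refine degreeSpan_induction (Q := fun a => a * b = (-1 : ℚ) ^ (m * n) • (b * a)) (by simp) ?_ ?_ ?_ ha
  · intro x y hx hy; rw [add_mul, mul_add, smul_add, hx, hy]
  · intro c x hx; rw [smul_mul_assoc, mul_smul_comm, hx, smul_comm]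
  rintro l rfl
  refine degreeSpan_induction
    (Q := fun b => listProd l * b = (-1 : ℚ) ^ (listDeg l * n) • (b * listProd l)) (by simp) ?_ ?_ ?_ hb
  · intro x y hx hy; rw [add_mul, mul_add, smul_add, hx, hy]
  · intro c x hx; rw [smul_mul_assoc, mul_smul_comm, hx, smul_comm]
  rintro l' rfl
  exact listProd_comm l l'

/-- The homomorphism to a commutative algebra that extends linear maps on `V^odd` and `V^even`. -/
def lift {B : Type v} [CommRing B] [Algebra ℚ B] (o : OddPart V →ₗ[ℚ] B) (ho : ∀ x, o x * o x = 0)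
    (e : EvenPart V →ₗ[ℚ] B) : FreeCGA V →ₐ[ℚ] B :=
  (Algebra.TensorProduct.lift (ExteriorAlgebra.lift ℚ ⟨o, ho⟩) (SymmetricAlgebra.lift e)
    fun _ _ => Commute.all _ _ :
    ExteriorAlgebra ℚ (OddPart V) ⊗[ℚ] SymmetricAlgebra ℚ (EvenPart V) →ₐ[ℚ] B)

section Lift

variable {B : Type v} [CommRing B] [Algebra ℚ B] {o : OddPart V →ₗ[ℚ] B} {ho : ∀ x, o x * o x = 0}
  {e : EvenPart V →ₗ[ℚ] B}

theorem lift_evenIncl (p : SymmetricAlgebra ℚ (EvenPart V)) :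
    lift o ho e (evenIncl V p) = SymmetricAlgebra.lift e p := by
  change Algebra.TensorProduct.lift _ _ _ (1 ⊗ₜ[ℚ] p) = _
  rw [Algebra.TensorProduct.lift_tmul, map_one, one_mul]

theorem lift_gen_even {n : ℕ} (h : Even n) (x : V n) : lift o ho e (gen V n x) =
    e (DirectSum.lof ℚ {n : ℕ // Even n} (fun m => V m.1) ⟨n, h⟩ x) := by
  rw [gen_of_even h, lift_evenIncl, SymmetricAlgebra.lift_ι_apply]

theorem lift_gen_odd {n : ℕ} (h : ¬ Even n) (x : V n) : lift o ho e (gen V n x) =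
    o (DirectSum.lof ℚ {n : ℕ // ¬ Even n} (fun m => V m.1) ⟨n, h⟩ x) := by
  rw [gen_of_odd h]
  change Algebra.TensorProduct.lift _ _ _ (_ ⊗ₜ[ℚ] 1) = _
  rw [Algebra.TensorProduct.lift_tmul, map_one, mul_one, ExteriorAlgebra.lift_ι_apply]

end Lift

end FreeAlgebra

/-! ### Augmentation, cohomology classes and the lower grading of pure algebras -/

section

variable {V : ℕ → Type u} [∀ n, AddCommGroup (V n)] [∀ n, Module ℚ (V n)]

theorem lowerPart_succ_induction {i : ℕ} {Q : FreeCGA V → Prop}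
    (hadd : ∀ a b, Q a → Q b → Q (a + b))
    (hmul : ∀ v, ∀ y ∈ lowerPart V i, Q (oddIncl V (ExteriorAlgebra.ι ℚ v) * y)) {x : FreeCGA V}
    (hx : x ∈ lowerPart V (i + 1)) : Q x := by
  refine lowerPart_induction hadd ?_ hx
  intro a ha p
  rw [ExteriorAlgebra.exteriorPower, pow_succ'] at ha
  refine Submodule.mul_induction_on (C := fun a => Q (oddIncl V a * evenIncl V p)) ha ?_ ?_
  · rintro _ ⟨v, rfl⟩ b hb
    rw [map_mul, mul_assoc]
    exact hmul v _ (mem_lowerPart_of_mul hb p)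
  · intro a b ha hb; rw [map_add, add_mul]; exact hadd _ _ ha hb

/-- The augmentation of `ΛV`. -/
def aug : FreeCGA V →ₐ[ℚ] ℚ := lift 0 (by simp) 0

theorem aug_gen (n : ℕ) (x : V n) : aug (gen V n x) = 0 := by
  by_cases h : Even n
  · rw [aug, lift_gen_even h]; rfl
  · rw [aug, lift_gen_odd h]; rfl

theorem aug_of_mem {n : ℕ} (hn : n ≠ 0) {a : FreeCGA V} (ha : a ∈ degreePart V n) : aug a = 0 := by
  rw [degreePart_eq] at ha
  refine degreeSpan_induction (Q := fun a => aug a = 0) (map_zero _) ?_ ?_ ?_ ha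
  · intro a b ha hb; rw [map_add, ha, hb, add_zero]
  · intro c a ha; rw [map_smul, ha, smul_zero]
  rintro (_ | ⟨x, l⟩) rfl
  · exact absurd rfl hn
  · rw [listProd_cons, map_mul, aug_gen, zero_mul]

namespace SullivanAlgebra

variable (A : SullivanAlgebra V)

theorem leibniz_even {a : FreeCGA V} (ha : a ∈ degreeSpan V Even) (b : FreeCGA V) :
    A.d (a * b) = A.d a * b + a * A.d b := by
  refine degreeSpan_induction (Q := fun a => A.d (a * b) = A.d a * b + a * A.d b) (by simp)
    ?_ ?_ ?_ ha
  · intro x y hx hy; rw [add_mul, map_add, map_add, hx, hy, add_mul, add_mul]; abel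
  · intro c x hx
    rw [smul_mul_assoc, map_smul, map_smul, hx, smul_add, smul_mul_assoc, smul_mul_assoc]
  · intro l hl
    rw [A.leibniz _ _ (listProd_mem (P := (· = listDeg l)) rfl), hl.neg_one_pow, one_smul]

theorem leibniz_odd {a : FreeCGA V} (ha : a ∈ degreeSpan V (fun n => ¬ Even n)) (b : FreeCGA V) :
    A.d (a * b) = A.d a * b - a * A.d b := by
  refine degreeSpan_induction (Q := fun a => A.d (a * b) = A.d a * b - a * A.d b) (by simp)
    ?_ ?_ ?_ ha
  · intro x y hx hy; rw [add_mul, map_add, map_add, hx, hy, add_mul, add_mul]; abel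
  · intro c x hx
    rw [smul_mul_assoc, map_smul, map_smul, hx, smul_sub, smul_mul_assoc, smul_mul_assoc]
  · intro l hl
    rw [A.leibniz _ _ (listProd_mem (P := (· = listDeg l)) rfl),
      (Nat.not_even_iff_odd.1 hl).neg_one_pow, neg_one_smul, sub_eq_add_neg]

theorem d_one : A.d 1 = 0 := by
  have := A.leibniz_even (one_mem_degreeSpan (by simp : Even 0)) 1
  simpa using this

/-- The differential raises degree, so boundaries live in positive degrees, where the augmentation
vanishes. -/
theorem aug_d (a : FreeCGA V) : aug (A.d a) = 0 := by
  refine comp_induction isInternal_degreePart (P := fun a => aug (A.d a) = 0) ?_ ?_ a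
  · intro a b ha hb; rw [map_add, map_add, ha, hb, add_zero]
  · intro k a ha; exact aug_of_mem k.succ_ne_zero (A.d_mem k a ha)

theorem comp_degree_d (k : ℕ) (a : FreeCGA V) :
    comp isInternal_degreePart (k + 1) (A.d a) = A.d (comp isInternal_degreePart k a) :=
  comp_map _ (A.d_mem k)
    (fun j hj a ha => comp_of_mem_ne _ (by omega) (A.d_mem j a ha)) a

theorem comp_degree_d_mem_range (k : ℕ) (a : FreeCGA V) :
    ∃ w, A.d w = comp isInternal_degreePart k (A.d a) := by
  cases k with
  | succ k => exact ⟨_, (A.comp_degree_d k a).symm⟩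
  | zero =>
    refine ⟨0, ?_⟩
    rw [map_zero]
    refine comp_induction isInternal_degreePart
      (P := fun a => 0 = comp isInternal_degreePart 0 (A.d a)) ?_ ?_ a
    · intro a b ha hb; rw [map_add, map_add, ← ha, ← hb, add_zero]
    · intro k a ha; exact (comp_of_mem_ne _ (by omega) (A.d_mem k a ha)).symm

/-- The cohomology class of a cocycle. -/
def cls (z : FreeCGA V) (hz : A.d z = 0) : A.Cohomology := Submodule.mkQ _ ⟨z, hz⟩

variable {A}

theorem cls_eq_zero_iff {z : FreeCGA V} {hz : A.d z = 0} : A.cls z hz = 0 ↔ ∃ w, A.d w = z := by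
  rw [cls, Submodule.mkQ_apply, Submodule.Quotient.mk_eq_zero]; rfl

theorem cls_eq_iff {z z' : FreeCGA V} {hz : A.d z = 0} {hz' : A.d z' = 0} :
    A.cls z hz = A.cls z' hz' ↔ ∃ w, A.d w = z - z' := by
  rw [← sub_eq_zero, show A.cls z hz - A.cls z' hz' = A.cls (z - z') (by rw [map_sub, hz, hz', sub_zero])
    from (map_sub (Submodule.mkQ _) _ _).symm, cls_eq_zero_iff]

theorem mem_classesIn {S : Submodule ℚ (FreeCGA V)} {x : A.Cohomology} :
    x ∈ A.classesIn S ↔ ∃ z ∈ S, ∃ hz : A.d z = 0, A.cls z hz = x := by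
  constructor
  · rintro ⟨⟨z, hz⟩, h, rfl⟩; exact ⟨z, h, hz, rfl⟩
  · rintro ⟨z, h, hz, rfl⟩; exact ⟨⟨z, hz⟩, h, rfl⟩

/-- Since d is homogeneous, the components of a cocycle are cocycles, so sums of homogeneous even
classes are the classes of single, possibly inhomogeneous, even cocycles. -/
theorem mem_evenH_iff {x : A.Cohomology} :
    x ∈ A.evenH ↔ ∃ z ∈ degreeSpan V Even, ∃ hz : A.d z = 0, A.cls z hz = x := by
  rw [← mem_classesIn]
  constructor
  · intro h
    have : A.evenH ≤ A.classesIn (degreeSpan V Even) := by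
      refine iSup₂_le fun n hn => Submodule.map_mono (Submodule.comap_mono ?_)
      exact Submodule.span_mono (by rintro _ ⟨l, hl, rfl⟩; exact ⟨l, Eq.subst (motive := Even) hl.symm hn, rfl⟩)
    exact this h
  · rw [mem_classesIn]
    rintro ⟨z, hz, hdz, rfl⟩
    obtain ⟨s, hs⟩ := exists_sum_comp isInternal_degreePart z
    have hc : ∀ k, A.d (comp isInternal_degreePart k z) = 0 := fun k => by
      rw [← comp_degree_d, hdz, map_zero]
    have e : A.cls z hdz = ∑ k ∈ s, A.cls (comp isInternal_degreePart k z) (hc k) := by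
      simp only [cls, ← map_sum]
      congr 1
      apply Subtype.ext
      rw [Submodule.coe_sum]; exact hs
    rw [e]
    refine Submodule.sum_mem _ fun k _ => ?_
    by_cases hk : Even k
    · exact Submodule.mem_iSup_of_mem k (Submodule.mem_iSup_of_mem hk
        (mem_classesIn.2 ⟨_, comp_mem _ k z, hc k, rfl⟩))
    · have : comp isInternal_degreePart k z = 0 :=
        comp_eq_zero_of_mem_iSup _ (degreeSpan_le_iSup _ hz) hk
      rw [cls_eq_zero_iff.2 ⟨0, by rw [this, map_zero]⟩]
      exact zero_mem _

section Pure

variable (hA : A.IsPure)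
include hA

theorem IsPure.d_evenIncl (p : SymmetricAlgebra ℚ (EvenPart V)) : A.d (evenIncl V p) = 0 := by
  induction p using SymmetricAlgebra.induction with
  | algebraMap r =>
    rw [AlgHom.commutes, Algebra.algebraMap_eq_smul_one, map_smul, d_one, smul_zero]
  | ι x =>
    induction x using DirectSum.induction_on with
    | zero => simp
    | of i x =>
      have := hA.1 i.1 i.2 x
      rw [gen_of_even i.2] at this
      exact this
    | add x y hx hy => rw [map_add, map_add, map_add, hx, hy, add_zero]
  | mul a b ha hb =>
    rw [map_mul, leibniz_even _ (evenIncl_mem_degreeSpan a), ha, hb, zero_mul, mul_zero, add_zero]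
  | add a b ha hb => rw [map_add, map_add, ha, hb, add_zero]

theorem IsPure.d_evenIncl_mul (p : SymmetricAlgebra ℚ (EvenPart V)) (x : FreeCGA V) :
    A.d (evenIncl V p * x) = evenIncl V p * A.d x := by
  rw [leibniz_even _ (evenIncl_mem_degreeSpan p), hA.d_evenIncl, zero_mul, zero_add]

theorem IsPure.exists_d_ι (v : OddPart V) :
    ∃ p, evenIncl V p = A.d (oddIncl V (ExteriorAlgebra.ι ℚ v)) := by
  induction v using DirectSum.induction_on with
  | zero => exact ⟨0, by simp⟩
  | of i x =>
    obtain ⟨p, hp⟩ := hA.2 i.1 (Nat.not_even_iff_odd.1 i.2) x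
    rw [gen_of_odd i.2] at hp
    exact ⟨p, hp⟩
  | add x y hx hy =>
    obtain ⟨p, hp⟩ := hx
    obtain ⟨q, hq⟩ := hy
    exact ⟨p + q, by rw [map_add, map_add, map_add, map_add, hp, hq]⟩

theorem IsPure.d_lowerPart_zero {x : FreeCGA V} (hx : x ∈ lowerPart V 0) : A.d x = 0 := by
  obtain ⟨p, rfl⟩ := mem_lowerPart_zero.1 hx
  exact hA.d_evenIncl p

omit hA in
theorem d_ι_mul (v : OddPart V) (x : FreeCGA V) :
    A.d (oddIncl V (ExteriorAlgebra.ι ℚ v) * x) =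
      A.d (oddIncl V (ExteriorAlgebra.ι ℚ v)) * x - oddIncl V (ExteriorAlgebra.ι ℚ v) * A.d x :=
  leibniz_odd _ (oddIncl_ι_mem_degreeSpan v) x

/-- Purity trades one odd generator for an element of ΛV^even, so d is homogeneous of lower degree
-1. -/
theorem IsPure.d_mem_lowerPart {i : ℕ} {x : FreeCGA V} (hx : x ∈ lowerPart V (i + 1)) :
    A.d x ∈ lowerPart V i := by
  induction i generalizing x with
  | zero =>
    refine lowerPart_succ_induction (Q := fun x => A.d x ∈ lowerPart V 0) ?_ ?_ hx
    · intro a b ha hb; rw [map_add]; exact add_mem ha hb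
    intro v y hy
    rw [d_ι_mul, hA.d_lowerPart_zero hy, mul_zero, sub_zero]
    obtain ⟨p, hp⟩ := hA.exists_d_ι v
    rw [← hp]
    exact mul_mem_lowerPart (i := 0) (j := 0) (evenIncl_mem_lowerPart p) hy
  | succ i ih =>
    refine lowerPart_succ_induction (Q := fun x => A.d x ∈ lowerPart V (i + 1)) ?_ ?_ hx
    · intro a b ha hb; rw [map_add]; exact add_mem ha hb
    intro v y hy
    rw [d_ι_mul]
    obtain ⟨p, hp⟩ := hA.exists_d_ι v
    rw [← hp]
    refine sub_mem ?_ ?_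
    · simpa using mul_mem_lowerPart (evenIncl_mem_lowerPart p) hy
    · rw [add_comm i 1]; exact mul_mem_lowerPart (oddIncl_ι_mem_lowerPart v) (ih hy)

theorem IsPure.comp_lower_d (k : ℕ) (a : FreeCGA V) :
    comp isInternal_lowerPart k (A.d a) = A.d (comp isInternal_lowerPart (k + 1) a) := by
  refine comp_map _ (fun a => hA.d_mem_lowerPart) (fun j hj a ha => ?_) a
  cases j with
  | zero => rw [hA.d_lowerPart_zero ha, map_zero]
  | succ j => exact comp_of_mem_ne _ (by omega) (hA.d_mem_lowerPart ha)

theorem IsPure.d_comp_lower {z : FreeCGA V} (hz : A.d z = 0) (k : ℕ) :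
    A.d (comp isInternal_lowerPart k z) = 0 := by
  cases k with
  | zero => exact hA.d_lowerPart_zero (comp_mem _ 0 z)
  | succ k => rw [← hA.comp_lower_d, hz, map_zero]

omit hA in
theorem lowerH_zero_le_evenH : A.lowerH 0 ≤ A.evenH := by
  intro x hx
  obtain ⟨z, hz, hdz, rfl⟩ := mem_classesIn.1 hx
  obtain ⟨p, rfl⟩ := mem_lowerPart_zero.1 hz
  exact mem_evenH_iff.2 ⟨_, evenIncl_mem_degreeSpan p, hdz, rfl⟩

/-- An even cocycle has components only in lower degrees 0, 2, 4, …, each a cocycle. Those from 2 on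
are boundaries, so the component of degree 0 represents the same class. -/
theorem IsPure.evenH_le_lowerH_zero
    (h : ∀ i, 2 ≤ i → ∀ z ∈ lowerPart V i, A.d z = 0 → ∃ w, A.d w = z) : A.evenH ≤ A.lowerH 0 := by
  intro x hx
  obtain ⟨z, hz, hdz, rfl⟩ := mem_evenH_iff.1 hx
  refine mem_classesIn.2 ⟨comp isInternal_lowerPart 0 z, comp_mem _ 0 z, hA.d_comp_lower hdz 0, ?_⟩
  obtain ⟨s, hs⟩ := exists_sum_comp isInternal_lowerPart z
  have h1 : ∀ k, k ≠ 0 → comp isInternal_lowerPart k z ∈ LinearMap.range A.d := by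
    intro k hk
    by_cases hk' : Even k
    · exact h k (by rcases hk' with ⟨j, rfl⟩; omega) _ (comp_mem _ k z) (hA.d_comp_lower hdz k)
    · rw [comp_eq_zero_of_mem_iSup _ (degreeSpan_even_le hz) hk']; exact zero_mem _
  rw [eq_comm, cls_eq_iff]
  change _ ∈ LinearMap.range A.d
  have h2 : z - comp isInternal_lowerPart 0 z =
      ∑ k ∈ s, (if k = 0 then 0 else comp isInternal_lowerPart k z) := by
    rw [Finset.sum_ite, Finset.sum_const_zero, zero_add, sub_eq_iff_eq_add]
    by_cases h0 : 0 ∈ s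
    · conv_lhs => rw [hs]
      rw [← Finset.sum_filter_add_sum_filter_not s (fun k => k = 0), add_comm]
      congr 1
      rw [Finset.filter_eq', if_pos h0, Finset.sum_singleton]
    · have h3 : comp isInternal_lowerPart 0 z = 0 := by
        conv_lhs => rw [hs]
        rw [map_sum]
        refine Finset.sum_eq_zero fun k hk => ?_
        exact comp_of_mem_ne _ (by rintro rfl; exact h0 hk) (comp_mem _ k z)
      conv_lhs => rw [hs]
      rw [h3, add_zero, Finset.filter_true_of_mem (by rintro k hk rfl; exact h0 hk)]
  rw [h2]
  refine Submodule.sum_mem _ fun k _ => ?_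
  split_ifs with h0
  · exact zero_mem _
  · exact h1 k h0

/-- If z' in ΛV^even satisfied d w = z' - z, comparing components of lower degree 0 would give z' =
d w_1, so z would be a boundary. Only that component of z has to vanish, because morphisms need not
preserve the lower grading. -/
theorem IsPure.not_mem_lowerH_zero {z : FreeCGA V} (hdz : A.d z = 0)
    (h0 : comp isInternal_lowerPart 0 z = 0) (h : ∀ w, A.d w ≠ z) :
    A.cls z hdz ∉ A.lowerH 0 := by
  intro hx
  obtain ⟨z', hz', hdz', e⟩ := mem_classesIn.1 hx
  obtain ⟨w, hw⟩ := cls_eq_iff.1 e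
  have := congrArg (comp (isInternal_lowerPart (V := V)) 0) hw
  rw [hA.comp_lower_d, map_sub, h0, sub_zero, comp_of_mem _ hz'] at this
  refine h (comp isInternal_lowerPart 1 w - w) ?_
  rw [map_sub, this, hw]; abel

end Pure

end SullivanAlgebra

end

section

open Koszul

variable {V : ℕ → Type u} [∀ n, AddCommGroup (V n)] [∀ n, Module ℚ (V n)]

/-! ### The Koszul complex inside `ΛV` -/

section ChainMap

variable {m n : ℕ} (bE : Module.Basis (Fin m) ℚ (EvenPart V)) (y : ℕ → OddPart V)

/-- The inclusion of the polynomial algebra on a basis of `V^even`. -/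
def polyIncl : MvPolynomial (Fin m) ℚ →ₐ[ℚ] FreeCGA V :=
  (evenIncl V).comp (SymmetricAlgebra.equivMvPolynomial bE).symm.toAlgHom

theorem polyIncl_equiv (p : SymmetricAlgebra ℚ (EvenPart V)) :
    polyIncl bE (SymmetricAlgebra.equivMvPolynomial bE p) = evenIncl V p :=
  congrArg (evenIncl V) ((SymmetricAlgebra.equivMvPolynomial bE).symm_apply_apply p)

theorem polyIncl_comm (p : MvPolynomial (Fin m) ℚ) (x : FreeCGA V) :
    polyIncl bE p * x = x * polyIncl bE p := evenIncl_comm _ x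

theorem polyIncl_injective : Function.Injective (polyIncl bE) := by
  have h : Function.Injective (evenIncl V) :=
    Algebra.TensorProduct.includeRight_injective
      (ExteriorAlgebra.algebraMap_leftInverse (OddPart V)).injective
  exact h.comp (SymmetricAlgebra.equivMvPolynomial bE).symm.injective

/-- The inclusion of `V^odd`. -/
def oddGen : OddPart V →ₗ[ℚ] FreeCGA V := (oddIncl V).toLinearMap ∘ₗ ExteriorAlgebra.ι ℚ

theorem oddGen_apply (v : OddPart V) : oddGen v = oddIncl V (ExteriorAlgebra.ι ℚ v) := rfl

theorem oddGen_mul_self (v : OddPart V) : oddGen v * oddGen v = 0 := by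
  rw [oddGen_apply, ← map_mul, ExteriorAlgebra.ι_sq_zero, map_zero]

theorem oddGen_mul_comm (v w : OddPart V) : oddGen v * oddGen w = -(oddGen w * oddGen v) := by
  rw [oddGen_apply, oddGen_apply, ← map_mul (oddIncl V), ← map_mul (oddIncl V), ← map_neg]
  congr 1
  rw [eq_neg_iff_add_eq_zero]
  exact ExteriorAlgebra.ι_add_mul_swap _ _

/-- The map from the Koszul complex to `ΛV`. -/
def chainMap : ∀ k, Chain (MvPolynomial (Fin m) ℚ) k →+ FreeCGA V
  | 0 => (polyIncl bE).toLinearMap.toAddMonoidHom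
  | k + 1 =>
    -- The pair (a, b) goes to a + y_k b, as the signs of `diff` and `lmul` presuppose.
    (chainMap k).comp (AddMonoidHom.fst _ _) +
      (AddMonoidHom.mulLeft (oddGen (y k))).comp ((chainMap k).comp (AddMonoidHom.snd _ _))

variable {bE y}

theorem chainMap_succ (k : ℕ) (z : Chain (MvPolynomial (Fin m) ℚ) (k + 1)) :
    chainMap bE y (k + 1) z = chainMap bE y k z.1 + oddGen (y k) * chainMap bE y k z.2 := rfl

theorem chainMap_smul (r : MvPolynomial (Fin m) ℚ) :
    ∀ (k : ℕ) (z : Chain (MvPolynomial (Fin m) ℚ) k),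
      chainMap bE y k (r • z) = polyIncl bE r * chainMap bE y k z
  | 0, z => map_mul (polyIncl bE) r (show MvPolynomial (Fin m) ℚ from z)
  | k + 1, z => by
    rw [chainMap_succ, chainMap_succ]
    change chainMap bE y k (r • z.1) + _ * chainMap bE y k (r • z.2) = _
    rw [chainMap_smul r k, chainMap_smul r k, mul_add, ← mul_assoc,
      ← mul_assoc _ (oddGen (y k)), polyIncl_comm bE r (oddGen (y k))]

/-- Moving the earlier generators past y_k produces the sign in `lmul`. Since products v x can thus
be formed in the Koszul complex, its image contains all of ΛV. -/
theorem chainMap_lmul (c : ℕ → ℚ) : ∀ (k : ℕ) (z : Chain (MvPolynomial (Fin m) ℚ) k),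
    chainMap bE y k (lmul (fun j => MvPolynomial.C (c j)) k z) =
      oddGen (∑ j ∈ Finset.range k, c j • y j) * chainMap bE y k z
  | 0, z => by simp [lmul]
  | k + 1, z => by
    rw [chainMap_succ, chainMap_succ, lmul_succ, Finset.sum_range_succ]
    change chainMap bE y k (lmul _ k z.1) +
      oddGen (y k) * chainMap bE y k (MvPolynomial.C (c k) • z.1 - lmul _ k z.2) = _
    rw [map_sub, chainMap_lmul c k, chainMap_lmul c k, chainMap_smul, map_add, map_smul,
      show polyIncl bE (MvPolynomial.C (c k)) = algebraMap ℚ _ (c k) from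
        (polyIncl bE).commutes (c k), ← Algebra.smul_def]
    set η := oddGen (∑ j ∈ Finset.range k, c j • y j)
    have h1 := oddGen_mul_comm (∑ j ∈ Finset.range k, c j • y j) (y k)
    have h2 := oddGen_mul_self (y k)
    rw [add_mul, mul_add, mul_add, ← mul_assoc, h1, smul_mul_assoc, smul_mul_assoc,
      ← mul_assoc (oddGen (y k)) (oddGen (y k)), h2, mul_sub, mul_smul_comm, neg_mul, mul_assoc]
    simp only [zero_mul, smul_zero, add_zero]
    abel

theorem chainMap_mem : ∀ {k i : ℕ} {z : Chain (MvPolynomial (Fin m) ℚ) k}, z ∈ deg k i →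
    chainMap bE y k z ∈ lowerPart V i
  | 0, 0, z, _ => evenIncl_mem_lowerPart _
  | 0, i + 1, z, hz => by
    rw [show z = 0 from hz, map_zero]; exact zero_mem _
  | k + 1, 0, z, hz => by
    rw [chainMap_succ, (mem_deg_succ_zero.1 hz).2, map_zero, mul_zero, add_zero]
    exact chainMap_mem hz.1
  | k + 1, i + 1, z, hz => by
    rw [chainMap_succ]
    refine add_mem (chainMap_mem hz.1) ?_
    rw [add_comm i 1]
    exact mul_mem_lowerPart (oddIncl_ι_mem_lowerPart _) (chainMap_mem hz.2)

theorem chainMap_bot (p : MvPolynomial (Fin m) ℚ) :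
    ∀ k, chainMap bE y k (bot k p) = polyIncl bE p
  | 0 => rfl
  | k + 1 => by
    rw [chainMap_succ]
    change chainMap bE y k (bot k p) + _ * chainMap bE y k 0 = _
    rw [chainMap_bot p k, map_zero, mul_zero, add_zero]

/-- If the `y j` generate `V^odd`, then every element of lower degree `i` comes from the Koszul
complex. -/
theorem exists_chainMap_eq (hy : ∀ v, ∃ c : ℕ → ℚ, v = ∑ j ∈ Finset.range n, c j • y j) {i : ℕ} :
    ∀ {x : FreeCGA V}, x ∈ lowerPart V i → ∃ z ∈ deg n i, chainMap bE y n z = x := by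
  induction i with
  | zero =>
    intro x hx
    obtain ⟨p, rfl⟩ := mem_lowerPart_zero.1 hx
    exact ⟨bot n (SymmetricAlgebra.equivMvPolynomial bE p), bot_mem_deg _ _, by
      rw [chainMap_bot, polyIncl_equiv]⟩
  | succ i ih =>
    intro x hx
    refine lowerPart_succ_induction (Q := fun x => ∃ z ∈ deg n (i + 1), chainMap bE y n z = x)
      ?_ ?_ hx
    · rintro _ _ ⟨z, hz, rfl⟩ ⟨z', hz', rfl⟩
      exact ⟨z + z', add_mem hz hz', map_add _ _ _⟩
    · intro v x hx
      obtain ⟨z, hz, rfl⟩ := ih hx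
      obtain ⟨c, rfl⟩ := hy v
      exact ⟨_, lmul_mem_deg hz, chainMap_lmul c n z⟩

/-- The contraction of the exterior factor with a linear form. -/
def contract (φ : Module.Dual ℚ (OddPart V)) : FreeCGA V →ₗ[ℚ] FreeCGA V :=
  (TensorProduct.map (CliffordAlgebra.contractLeft (Q := (0 : QuadraticForm ℚ (OddPart V))) φ)
    LinearMap.id :
    ExteriorAlgebra ℚ (OddPart V) ⊗[ℚ] SymmetricAlgebra ℚ (EvenPart V) →ₗ[ℚ]
      ExteriorAlgebra ℚ (OddPart V) ⊗[ℚ] SymmetricAlgebra ℚ (EvenPart V))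

theorem contract_mul (φ : Module.Dual ℚ (OddPart V)) (a : ExteriorAlgebra ℚ (OddPart V))
    (p : SymmetricAlgebra ℚ (EvenPart V)) : contract φ (oddIncl V a * evenIncl V p) =
      oddIncl V (CliffordAlgebra.contractLeft (Q := (0 : QuadraticForm ℚ (OddPart V))) φ a) *
        evenIncl V p := by
  rw [oddIncl_mul_evenIncl, oddIncl_mul_evenIncl]
  exact TensorProduct.map_tmul _ _ _ _

theorem contract_evenIncl (φ : Module.Dual ℚ (OddPart V)) (p : SymmetricAlgebra ℚ (EvenPart V)) :
    contract φ (evenIncl V p) = 0 := by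
  have := contract_mul φ 1 p
  rwa [map_one, one_mul, CliffordAlgebra.contractLeft_one, map_zero, zero_mul] at this

theorem contract_oddGen_mul (φ : Module.Dual ℚ (OddPart V)) (v : OddPart V) (x : FreeCGA V) :
    contract φ (oddGen v * x) = φ v • x - oddGen v * contract φ x := by
  refine FreeCGA.tensor_induction
    (P := fun x => contract φ (oddGen v * x) = φ v • x - oddGen v * contract φ x) ?_ ?_ x
  · intro a b ha hb; rw [mul_add, map_add, map_add, ha, hb, smul_add, mul_add]; abel
  · intro a p
    rw [oddGen_apply, ← mul_assoc, ← map_mul, contract_mul, contract_mul]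
    rw [show CliffordAlgebra.contractLeft (Q := (0 : QuadraticForm ℚ (OddPart V))) φ
      (ExteriorAlgebra.ι ℚ v * a) = _ from CliffordAlgebra.contractLeft_ι_mul φ v a]
    rw [map_sub, map_smul, sub_mul, smul_mul_assoc, map_mul, mul_assoc]

theorem contract_chainMap {φ : Module.Dual ℚ (OddPart V)} : ∀ {k : ℕ}, (∀ j < k, φ (y j) = 0) →
    ∀ z, contract φ (chainMap bE y k z) = 0
  | 0, _, z => contract_evenIncl φ _
  | k + 1, h, z => by
    rw [chainMap_succ, map_add, contract_oddGen_mul,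
      contract_chainMap (fun j hj => h j (by omega)), contract_chainMap (fun j hj => h j (by omega)),
      h k (Nat.lt_succ_self k)]
    simp

/-- Contraction with a form that is 1 on y_k and 0 on the earlier y_j isolates the second
coordinate, so the coordinates can be read off one after the other. -/
theorem chainMap_injective : ∀ {k : ℕ}, (∀ i < k, ∃ φ : Module.Dual ℚ (OddPart V),
    φ (y i) = 1 ∧ ∀ j < i, φ (y j) = 0) → ∀ z, chainMap bE y k z = 0 → z = 0
  | 0, _, z, hz => polyIncl_injective bE (hz.trans (map_zero _).symm)
  | k + 1, h, z, hz => by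
    rw [chainMap_succ] at hz
    obtain ⟨φ, h1, h2⟩ := h k (Nat.lt_succ_self k)
    have h3 := congrArg (contract φ) hz
    rw [map_add, contract_oddGen_mul, contract_chainMap h2, contract_chainMap h2, h1, one_smul,
      mul_zero, sub_zero, zero_add, map_zero] at h3
    rw [h3, mul_zero, add_zero] at hz
    exact Prod.ext (chainMap_injective (fun i hi => h i (by omega)) _ hz)
      (chainMap_injective (fun i hi => h i (by omega)) _ h3)

theorem d_chainMap {A : SullivanAlgebra V} (hA : A.IsPure) {f : ℕ → MvPolynomial (Fin m) ℚ}
    (hf : ∀ j, polyIncl bE (f j) = A.d (oddGen (y j))) :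
    ∀ (k : ℕ) (z : Chain (MvPolynomial (Fin m) ℚ) k),
      A.d (chainMap bE y k z) = chainMap bE y k (diff f k z)
  | 0, z => by
    rw [show diff f 0 z = 0 from rfl, map_zero]; exact hA.d_evenIncl _
  | k + 1, z => by
    rw [chainMap_succ, map_add, oddGen_apply, SullivanAlgebra.d_ι_mul, ← oddGen_apply, ← hf,
      d_chainMap hA hf k, d_chainMap hA hf k]
    change _ = chainMap bE y k (diff f k z.1 + f k • z.2) +
      oddGen (y k) * chainMap bE y k (-diff f k z.2)
    rw [map_add, chainMap_smul, map_neg, mul_neg]; abel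

end ChainMap

/-! ### Pure elliptic algebras -/

theorem finite_evenPart (h : Module.Finite ℚ (⨁ n, V n)) : Module.Finite ℚ (EvenPart V) := by
  refine Module.Finite.of_surjective
    (DirectSum.toModule ℚ ℕ (EvenPart V) fun n => if hn : Even n then
      DirectSum.lof ℚ {n : ℕ // Even n} (fun m => V m.1) ⟨n, hn⟩ else 0) fun x => ?_
  induction x using DirectSum.induction_on with
  | zero => exact ⟨0, map_zero _⟩
  | of i x =>
    refine ⟨DirectSum.lof ℚ ℕ V i.1 x, ?_⟩
    rw [DirectSum.toModule_lof, dif_pos i.2]; rfl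
  | add x y hx hy =>
    obtain ⟨a, rfl⟩ := hx
    obtain ⟨b, rfl⟩ := hy
    exact ⟨a + b, map_add _ _ _⟩

theorem finite_oddPart (h : Module.Finite ℚ (⨁ n, V n)) : Module.Finite ℚ (OddPart V) := by
  refine Module.Finite.of_surjective
    (DirectSum.toModule ℚ ℕ (OddPart V) fun n => if hn : ¬ Even n then
      DirectSum.lof ℚ {n : ℕ // ¬ Even n} (fun m => V m.1) ⟨n, hn⟩ else 0) fun x => ?_
  induction x using DirectSum.induction_on with
  | zero => exact ⟨0, map_zero _⟩
  | of i x =>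
    refine ⟨DirectSum.lof ℚ ℕ V i.1 x, ?_⟩
    rw [DirectSum.toModule_lof, dif_pos i.2]; rfl
  | add x y hx hy =>
    obtain ⟨a, rfl⟩ := hx
    obtain ⟨b, rfl⟩ := hy
    exact ⟨a + b, map_add _ _ _⟩

namespace SullivanAlgebra

variable {A : SullivanAlgebra V}

/-- In finite-dimensional cohomology, some power of an even cocycle of positive degree is a
boundary. -/
theorem exists_pow_mem_range [Module.Finite ℚ A.Cohomology] {n : ℕ} (hn : 0 < n) {ξ : FreeCGA V}
    (hξ : ξ ∈ degreePart V n) (hd : ∀ j, A.d (ξ ^ j) = 0) : ∃ N w, A.d w = ξ ^ N := by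
  have hdeg : ∀ j, ξ ^ j ∈ degreePart V (j * n) := by
    intro j
    induction j with
    | zero =>
      rw [pow_zero, zero_mul]
      exact one_mem_degreeSpan (P := (· = 0)) rfl
    | succ j ih => rw [pow_succ, Nat.succ_mul]; exact mul_mem_degreePart ih hξ
  have h1 : ¬ LinearIndependent ℚ (fun j : ℕ => A.cls (ξ ^ j) (hd j)) := fun h =>
    not_finite_iff_infinite.2 (inferInstance : Infinite ℕ) h.finite
  rw [linearIndependent_iff'] at h1
  push Not at h1
  obtain ⟨s, c, hs, J, hJ, hc⟩ := h1
  have h2 : ∑ j ∈ s, c j • A.cls (ξ ^ j) (hd j) =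
      A.cls (∑ j ∈ s, c j • ξ ^ j) (by
        rw [map_sum]; exact Finset.sum_eq_zero fun j _ => by rw [map_smul, hd, smul_zero]) := by
    simp only [cls, ← map_smul, ← map_sum]
    congr 1
    apply Subtype.ext
    rw [Submodule.coe_sum]; rfl
  rw [h2, cls_eq_zero_iff] at hs
  obtain ⟨w, hw⟩ := hs
  -- The powers of ξ have distinct degrees, so the component of degree J n turns a linear relation
  -- among their classes into the vanishing of a single one.
  obtain ⟨w', hw'⟩ := A.comp_degree_d_mem_range (J * n) w
  rw [hw, map_sum, Finset.sum_eq_single J] at hw'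
  · rw [map_smul, comp_of_mem _ (hdeg J)] at hw'
    exact ⟨J, (c J)⁻¹ • w', by rw [map_smul, hw', smul_smul, inv_mul_cancel₀ hc, one_smul]⟩
  · intro j _ hj
    rw [map_smul, comp_of_mem_ne _ _ (hdeg j), smul_zero]
    exact fun h => hj (Nat.eq_of_mul_eq_mul_right hn h).symm
  · exact fun h => absurd hJ h

/-- The ideal of the elements of `ΛV^even` that are boundaries. -/
def IsPure.boundaryIdeal (hA : A.IsPure) : Ideal (SymmetricAlgebra ℚ (EvenPart V)) where
  carrier := {p | ∃ w, A.d w = evenIncl V p}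
  zero_mem' := ⟨0, by simp⟩
  add_mem' := by
    rintro p q ⟨w, hw⟩ ⟨w', hw'⟩
    exact ⟨w + w', by rw [map_add, map_add, hw, hw']⟩
  smul_mem' := by
    rintro c p ⟨w, hw⟩
    exact ⟨evenIncl V c * w, by rw [hA.d_evenIncl_mul, hw, smul_eq_mul, map_mul]⟩

/-- Homogeneous generators have a power that is a boundary. A radical is closed under sums, so this
extends to inhomogeneous elements and an arbitrary basis of V^even may be used. -/
theorem IsPure.ι_mem_radical (hA : A.IsPure) [Module.Finite ℚ A.Cohomology] (x : EvenPart V) :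
    SymmetricAlgebra.ι ℚ (EvenPart V) x ∈ hA.boundaryIdeal.radical := by
  induction x using DirectSum.induction_on with
  | zero => rw [map_zero]; exact zero_mem _
  | add x y hx hy => rw [map_add]; exact add_mem hx hy
  | of i x =>
    by_cases hi : i.1 = 0
    · obtain ⟨i, hi'⟩ := i
      subst hi
      have := A.subsingleton_zero
      rw [Subsingleton.elim x 0, map_zero, map_zero]; exact zero_mem _
    · have e := gen_of_even i.2 x
      obtain ⟨N, w, hw⟩ := exists_pow_mem_range (A := A) (Nat.pos_of_ne_zero hi)
        (gen_mem_degreePart i.1 x) (fun j => by rw [e, ← map_pow, hA.d_evenIncl])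
      exact ⟨N, w, by rw [hw, e, map_pow]; rfl⟩

/-- A pure elliptic algebra is the Koszul complex of a sequence of polynomials without constant
term whose ideal contains the `N`-th powers of the variables. -/
theorem IsPure.exists_koszul (hA : A.IsPure) (hE : A.IsElliptic) :
    ∃ (N : ℕ) (f : ℕ → MvPolynomial (Fin (Module.finrank ℚ (EvenPart V))) ℚ)
      (Φ : Chain (MvPolynomial (Fin (Module.finrank ℚ (EvenPart V))) ℚ)
        (Module.finrank ℚ (OddPart V)) →+ FreeCGA V),
      0 < N ∧ (∀ j, f j ∈ RingHom.ker (MvPolynomial.constantCoeff :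
        MvPolynomial (Fin (Module.finrank ℚ (EvenPart V))) ℚ →+* ℚ)) ∧
      RegularIn f (Module.finrank ℚ (OddPart V))
        (varPow (Module.finrank ℚ (EvenPart V)) N) (Module.finrank ℚ (EvenPart V)) ∧
      (∀ z, A.d (Φ z) = Φ (diff f _ z)) ∧ (∀ z, Φ z = 0 → z = 0) ∧
      (∀ i, ∀ z ∈ deg _ i, Φ z ∈ lowerPart V i) ∧
      (∀ i, ∀ x ∈ lowerPart V i, ∃ z ∈ deg _ i, Φ z = x) := by
  obtain ⟨hV, hH⟩ := hE
  have := finite_evenPart hV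
  have := finite_oddPart hV
  set m := Module.finrank ℚ (EvenPart V)
  set n := Module.finrank ℚ (OddPart V)
  let bE : Module.Basis (Fin m) ℚ (EvenPart V) := Module.finBasis ℚ _
  let bO : Module.Basis (Fin n) ℚ (OddPart V) := Module.finBasis ℚ _
  let y : ℕ → OddPart V := fun j => if h : j < n then bO ⟨j, h⟩ else 0
  have hf : ∀ j, ∃ p, polyIncl bE p = A.d (oddGen (y j)) := fun j => by
    obtain ⟨p, hp⟩ := hA.exists_d_ι (y j)
    exact ⟨_, (polyIncl_equiv bE p).trans hp⟩
  choose f hf using hf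
  have hspan : ∀ v, ∃ c : ℕ → ℚ, v = ∑ j ∈ Finset.range n, c j • y j := fun v => by
    refine ⟨fun j => if h : j < n then bO.repr v ⟨j, h⟩ else 0, ?_⟩
    rw [Finset.sum_range]
    conv_lhs => rw [← bO.sum_repr v]
    exact Finset.sum_congr rfl fun j _ => by simp [y]
  have hdual : ∀ i < n, ∃ φ : Module.Dual ℚ (OddPart V), φ (y i) = 1 ∧ ∀ j < i, φ (y j) = 0 := by
    intro i hi
    refine ⟨bO.coord ⟨i, hi⟩, by simp [y, hi], fun j hj => ?_⟩
    have : j < n := by omega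
    simp [y, this, hj.ne]
  have hinj := chainMap_injective (bE := bE) hdual
  have hmem : ∀ i : Fin m, MvPolynomial.X i ∈
      (hA.boundaryIdeal.comap (SymmetricAlgebra.equivMvPolynomial bE).symm.toRingEquiv).radical := by
    intro i
    rw [← Ideal.comap_radical, Ideal.mem_comap]
    have := SymmetricAlgebra.equivMvPolynomial_symm_X bE i
    change (SymmetricAlgebra.equivMvPolynomial bE).symm (MvPolynomial.X i) ∈ _
    rw [this]
    exact hA.ι_mem_radical _
  choose N hN using hmem
  -- One exponent for all variables; the added 1 makes it positive.
  have hpow : ∀ i : Fin m, ∃ w, A.d w =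
      polyIncl bE (MvPolynomial.X i ^ (Finset.univ.sup N + 1)) := fun i =>
    Ideal.pow_mem_of_pow_mem _ (hN i) ((Finset.le_sup (Finset.mem_univ i)).trans (Nat.le_succ _))
  refine ⟨Finset.univ.sup N + 1, f, chainMap bE y n, Nat.succ_pos _, ?_, ⟨?_, ?_⟩,
    d_chainMap hA hf n, hinj, fun i z => chainMap_mem, fun i x => exists_chainMap_eq hspan⟩
  · intro j
    -- On polynomials the augmentation is the constant term, and it vanishes on boundaries such as
    -- f_j.
    have h1 : (aug.comp (polyIncl bE)) = MvPolynomial.aeval (fun _ => (0 : ℚ)) := by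
      ext i
      rw [AlgHom.comp_apply, polyIncl, AlgHom.comp_apply]
      have := SymmetricAlgebra.equivMvPolynomial_symm_X bE i
      change aug (evenIncl V ((SymmetricAlgebra.equivMvPolynomial bE).symm (MvPolynomial.X i))) = _
      rw [this, aug, lift_evenIncl, SymmetricAlgebra.lift_ι_apply]
      simp
    have h2 := AlgHom.congr_fun h1 (f j)
    rw [AlgHom.comp_apply, hf, A.aug_d] at h2
    rw [RingHom.mem_ker, h2]
    exact (MvPolynomial.aeval_zero (f j)).symm
  · exact fun k hk x hx => varPow_regular hk x hx
  · intro k hk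
    obtain ⟨w, hw⟩ := hpow ⟨k, hk⟩
    -- Only the component of lower degree 1 of the primitive contributes to x_k^N. Pulled back to
    -- the Koszul complex, it exhibits x_k^N as a combination of the f_j.
    have h1 := congrArg (comp (isInternal_lowerPart (V := V)) 0) hw
    rw [hA.comp_lower_d, comp_of_mem (isInternal_lowerPart (V := V)) (show polyIncl bE _ ∈ _ from
      evenIncl_mem_lowerPart _)] at h1
    obtain ⟨z, hz, hz'⟩ := exists_chainMap_eq (bE := bE) hspan
      (comp_mem (isInternal_lowerPart (V := V)) (0 + 1) w)
    rw [← hz', d_chainMap hA hf n, ← chainMap_bot (bE := bE) (y := y) _ n, ← sub_eq_zero,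
      ← map_sub] at h1
    obtain ⟨c, hc⟩ := botCoord_diff_mem (f := f) n z
    refine ⟨c, ?_⟩
    rw [← hc, sub_eq_zero.1 (hinj _ h1), botCoord_bot, varPow, dif_pos hk]

theorem IsPure.exists_primitive (hA : A.IsPure) (hE : A.IsElliptic) {i : ℕ}
    (hi : A.homotopyEuler < i) {z : FreeCGA V} (hz : z ∈ lowerPart V i) (hdz : A.d z = 0) :
    ∃ w, A.d w = z := by
  obtain ⟨N, f, Φ, _, _, hreg, hd, hinj, _, hsurj⟩ := hA.exists_koszul hE
  obtain ⟨ζ, hζ, rfl⟩ := hsurj i z hz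
  rw [homotopyEuler] at hi
  obtain ⟨w, _, hw⟩ := kills_bot.1 (hreg.kills_one (i := i) (by omega)) ζ hζ
    (hinj _ (by rw [← hd, hdz]))
  exact ⟨Φ w, by rw [hd, ← hw, one_smul]⟩

theorem IsPure.exists_nonzero_two (hA : A.IsPure) (hE : A.IsElliptic)
    (h : 1 < A.homotopyEuler) :
    ∃ z ∈ lowerPart V 2, A.d z = 0 ∧ ∀ w, A.d w ≠ z := by
  obtain ⟨N, f, Φ, hN, hf, hreg, hd, hinj, hmem, hsurj⟩ := hA.exists_koszul hE
  rw [homotopyEuler] at h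
  have := hreg.not_kills_one (fun j _ => hf j) (socle_not_mem hN) (fun a => mul_socle_mem) (by omega)
  rw [kills_bot] at this
  push Not at this
  obtain ⟨ζ, hζ, hdζ, hne⟩ := this
  refine ⟨Φ ζ, hmem 2 ζ hζ, by rw [hd, hdζ, map_zero], fun w hw => ?_⟩
  -- A primitive may be replaced by its component of lower degree 3, which comes from the Koszul
  -- complex.
  have h1 := congrArg (comp (isInternal_lowerPart (V := V)) 2) hw
  rw [hA.comp_lower_d, comp_of_mem _ (hmem 2 ζ hζ)] at h1
  obtain ⟨ω, hω, hω'⟩ := hsurj 3 _ (comp_mem (isInternal_lowerPart (V := V)) (2 + 1) w)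
  rw [← hω', hd, ← sub_eq_zero, ← map_sub] at h1
  exact hne ω hω (by rw [one_smul, sub_eq_zero.1 (hinj _ h1)])

theorem IsPure.lowerH_zero_eq_evenH_iff (hA : A.IsPure) (hE : A.IsElliptic) :
    A.lowerH 0 = A.evenH ↔ A.homotopyEuler ≤ 1 := by
  refine ⟨fun h => ?_, fun h => le_antisymm lowerH_zero_le_evenH
    (hA.evenH_le_lowerH_zero fun i hi z hz hdz => hA.exists_primitive hE (by omega) hz hdz)⟩
  by_contra! hlt
  obtain ⟨z, hz, hdz, hne⟩ := hA.exists_nonzero_two hE hlt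
  refine hA.not_mem_lowerH_zero hdz (comp_of_mem_ne _ (by norm_num) hz) hne ?_
  rw [h]
  exact mem_evenH_iff.2 ⟨z, lowerPart_two_le hz, hdz, rfl⟩

end SullivanAlgebra

end

/-! ### Indecomposables -/

section Indecomposables

variable (V : ℕ → Type u) [∀ n, AddCommGroup (V n)] [∀ n, Module ℚ (V n)]

/-- The generators of `ΛV`, as the sum of the odd and the even part. -/
def Gens : Type u := OddPart V × EvenPart V

instance : AddCommGroup (Gens V) := inferInstanceAs (AddCommGroup (OddPart V × EvenPart V))

instance : Module ℚ (Gens V) := inferInstanceAs (Module ℚ (OddPart V × EvenPart V))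

instance : Module ℚᵐᵒᵖ (Gens V) := Module.compHom _ ((RingHom.id ℚ).fromOpposite mul_comm)

instance : IsCentralScalar ℚ (Gens V) := ⟨fun _ _ => rfl⟩

/-- The inclusion of the odd part. -/
def oddToGens : OddPart V →ₗ[ℚ] Gens V := LinearMap.inl ℚ (OddPart V) (EvenPart V)

/-- The inclusion of the even part. -/
def evenToGens : EvenPart V →ₗ[ℚ] Gens V := LinearMap.inr ℚ (OddPart V) (EvenPart V)

/-- Products of generators vanish in the square zero extension. The signs of ΛV are therefore
invisible there, and a commutative target suffices. -/
theorem inr_oddToGens_mul_self (x : OddPart V) :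
    (TrivSqZeroExt.inrHom ℚ (Gens V) ∘ₗ oddToGens V) x *
      (TrivSqZeroExt.inrHom ℚ (Gens V) ∘ₗ oddToGens V) x = 0 :=
  TrivSqZeroExt.inr_mul_inr ℚ (oddToGens V x) (oddToGens V x)

/-- The projection of `ΛV` to its part of word length at most one. -/
def linPart : FreeCGA V →ₐ[ℚ] TrivSqZeroExt ℚ (Gens V) :=
  lift (TrivSqZeroExt.inrHom ℚ (Gens V) ∘ₗ oddToGens V) (inr_oddToGens_mul_self V)
    (TrivSqZeroExt.inrHom ℚ (Gens V) ∘ₗ evenToGens V)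

variable {V}

theorem linPart_gen_even {n : ℕ} (h : Even n) (x : V n) : linPart V (gen V n x) =
    TrivSqZeroExt.inr (evenToGens V
      (DirectSum.lof ℚ {n : ℕ // Even n} (fun m => V m.1) ⟨n, h⟩ x)) := by
  rw [linPart, lift_gen_even h]; rfl

theorem linPart_gen_odd {n : ℕ} (h : ¬ Even n) (x : V n) : linPart V (gen V n x) =
    TrivSqZeroExt.inr (oddToGens V
      (DirectSum.lof ℚ {n : ℕ // ¬ Even n} (fun m => V m.1) ⟨n, h⟩ x)) := by
  rw [linPart, lift_gen_odd h]; rfl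

theorem fst_linPart (a : FreeCGA V) : (linPart V a).fst = aug a := by
  have : (TrivSqZeroExt.fstHom ℚ ℚ (Gens V)).comp (linPart V) = aug := by
    refine FreeCGA.algHom_ext fun n x => ?_
    rw [AlgHom.comp_apply, aug_gen]
    by_cases h : Even n
    · rw [linPart_gen_even h]; rfl
    · rw [linPart_gen_odd h]; rfl
  exact AlgHom.congr_fun this a

theorem linPart_evenIncl_ι (x : EvenPart V) :
    linPart V (evenIncl V (SymmetricAlgebra.ι ℚ _ x)) = TrivSqZeroExt.inr (evenToGens V x) := by
  rw [linPart, lift_evenIncl, SymmetricAlgebra.lift_ι_apply]; rfl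

theorem linPart_oddGen (x : OddPart V) :
    linPart V (oddGen x) = TrivSqZeroExt.inr (oddToGens V x) := by
  induction x using DirectSum.induction_on with
  | zero => simp
  | of i x =>
    have := linPart_gen_odd i.2 x
    rw [gen_of_odd i.2] at this
    exact this
  | add x y hx hy => rw [map_add, map_add, map_add, hx, hy, TrivSqZeroExt.inr_add]

theorem exists_linPart_eq (x : Gens V) : ∃ a, linPart V a = TrivSqZeroExt.inr x := by
  refine ⟨oddGen x.1 + evenIncl V (SymmetricAlgebra.ι ℚ _ x.2), ?_⟩
  rw [map_add, linPart_oddGen, linPart_evenIncl_ι, ← TrivSqZeroExt.inr_add]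
  congr 1
  exact Prod.ext (add_zero x.1) (zero_add x.2)

/-- A homomorphism to a square zero extension that sends generators to the square zero ideal
factors through the linear part. -/
theorem exists_map_linPart {M : Type v} [AddCommGroup M] [Module ℚ M] [Module ℚᵐᵒᵖ M]
    [IsCentralScalar ℚ M] (N : FreeCGA V →ₐ[ℚ] TrivSqZeroExt ℚ M)
    (hN : ∀ n x, (N (gen V n x)).fst = 0) :
    ∃ R : Gens V →ₗ[ℚ] M, N = (TrivSqZeroExt.map R).comp (linPart V) := by
  let R : Gens V →ₗ[ℚ] M :=
    ((TrivSqZeroExt.sndHom ℚ M ∘ₗ N.toLinearMap ∘ₗ oddGen).coprod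
      (TrivSqZeroExt.sndHom ℚ M ∘ₗ N.toLinearMap ∘ₗ (evenIncl V).toLinearMap ∘ₗ
        SymmetricAlgebra.ι ℚ (EvenPart V)) : (OddPart V × EvenPart V) →ₗ[ℚ] M)
  refine ⟨R, FreeCGA.algHom_ext fun n x => ?_⟩
  rw [AlgHom.comp_apply]
  by_cases h : Even n
  · rw [linPart_gen_even h, TrivSqZeroExt.map_inr]
    refine TrivSqZeroExt.ext (by rw [hN]; rfl) ?_
    rw [TrivSqZeroExt.snd_inr, gen_of_even h]
    change _ = (N (oddGen 0)).snd + _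
    rw [map_zero, map_zero, TrivSqZeroExt.snd_zero, zero_add]; rfl
  · rw [linPart_gen_odd h, TrivSqZeroExt.map_inr]
    refine TrivSqZeroExt.ext (by rw [hN]; rfl) ?_
    rw [TrivSqZeroExt.snd_inr, gen_of_odd h]
    change _ = _ + (N (evenIncl V (SymmetricAlgebra.ι ℚ (EvenPart V) 0))).snd
    rw [map_zero, map_zero, map_zero, TrivSqZeroExt.snd_zero, add_zero]; rfl

theorem snd_linPart_cons (x : Σ n, V n) (l : List (Σ n, V n)) :
    (linPart V (listProd (x :: l))).snd = aug (listProd l) • (linPart V (gen V x.1 x.2)).snd := by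
  rw [listProd_cons, map_mul, TrivSqZeroExt.snd_mul, fst_linPart, fst_linPart, aug_gen, zero_smul,
    zero_add, op_smul_eq_smul]

/-- If the first factor of an even product is odd, the remaining factors have odd, hence nonzero,
total degree and are killed by the augmentation. -/
theorem linPart_even {a : FreeCGA V} (ha : a ∈ degreeSpan V Even) :
    ((linPart V a).snd : OddPart V × EvenPart V).1 = 0 := by
  refine degreeSpan_induction
    (Q := fun a => ((linPart V a).snd : OddPart V × EvenPart V).1 = 0) (by simp; rfl) ?_ ?_ ?_ ha
  · intro a b ha hb
    rw [map_add]
    exact (congrArg₂ (· + ·) ha hb).trans (add_zero 0)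
  · intro c a ha
    rw [map_smul]
    exact (congrArg (c • ·) ha).trans (smul_zero c)
  · rintro (_ | ⟨x, l⟩) hl
    · simp [listProd]; rfl
    · rw [snd_linPart_cons]
      by_cases hx : Even x.1
      · rw [linPart_gen_even hx]
        exact smul_zero (aug (listProd l))
      · rw [aug_of_mem (n := listDeg l) _ (listProd_mem (P := (· = listDeg l)) rfl), zero_smul]
        · rfl
        · intro h0
          rw [listDeg_cons, h0, add_zero] at hl
          exact hx hl

theorem linPart_odd {a : FreeCGA V} (ha : a ∈ degreeSpan V (fun n => ¬ Even n)) :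
    ((linPart V a).snd : OddPart V × EvenPart V).2 = 0 := by
  refine degreeSpan_induction
    (Q := fun a => ((linPart V a).snd : OddPart V × EvenPart V).2 = 0) (by simp; rfl) ?_ ?_ ?_ ha
  · intro a b ha hb
    rw [map_add]
    exact (congrArg₂ (· + ·) ha hb).trans (add_zero 0)
  · intro c a ha
    rw [map_smul]
    exact (congrArg (c • ·) ha).trans (smul_zero c)
  · rintro (_ | ⟨x, l⟩) hl
    · simp [listProd]; rfl
    · rw [snd_linPart_cons]
      by_cases hx : Even x.1
      · rw [aug_of_mem (n := listDeg l) _ (listProd_mem (P := (· = listDeg l)) rfl), zero_smul]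
        · rfl
        · intro h0
          rw [listDeg_cons, h0, add_zero] at hl
          exact hl hx
      · rw [linPart_gen_odd hx]
        exact smul_zero (aug (listProd l))

end Indecomposables

/-! ### Morphisms -/

section Morphisms

variable {V : ℕ → Type u} [∀ n, AddCommGroup (V n)] [∀ n, Module ℚ (V n)]
variable {W : ℕ → Type v} [∀ n, AddCommGroup (W n)] [∀ n, Module ℚ (W n)]
variable {A : SullivanAlgebra V} {B : SullivanAlgebra W}

theorem DGHom.map_degreeSpan (f : DGHom A B) {P : ℕ → Prop} {a : FreeCGA V}
    (ha : a ∈ degreeSpan V P) : f.toAlgHom a ∈ degreeSpan W P := by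
  refine degreeSpan_induction (Q := fun a => f.toAlgHom a ∈ degreeSpan W P)
    (by rw [map_zero]; exact zero_mem _) ?_ ?_ ?_ ha
  · intro a b ha hb; rw [map_add]; exact add_mem ha hb
  · intro c a ha; rw [map_smul]; exact Submodule.smul_mem _ c ha
  · intro l hl
    have := f.map_degree _ _ (listProd_mem (P := (· = listDeg l)) rfl)
    refine Submodule.span_mono ?_ this
    rintro _ ⟨l', hl', rfl⟩
    exact ⟨l', Eq.subst (motive := P) (Eq.symm hl') hl, rfl⟩

theorem DGHom.aug_map (f : DGHom A B) (a : FreeCGA V) : aug (f.toAlgHom a) = aug a := by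
  have : aug.comp f.toAlgHom = aug := by
    refine FreeCGA.algHom_ext fun n x => ?_
    rw [AlgHom.comp_apply, aug_gen]
    by_cases hn : n = 0
    · subst hn
      have := A.subsingleton_zero
      rw [Subsingleton.elim x 0, map_zero, map_zero, map_zero]
    · exact aug_of_mem hn (f.map_degree n _ (gen_mem_degreePart n x))
  exact AlgHom.congr_fun this a

/-- Morphisms preserve the ideal of the elements of positive lower degree. -/
theorem DGHom.comp_zero_map_eq_zero (f : DGHom A B) {i : ℕ} {x : FreeCGA V}
    (hx : x ∈ lowerPart V (i + 1)) : comp isInternal_lowerPart 0 (f.toAlgHom x) = 0 := by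
  refine lowerPart_succ_induction
    (Q := fun x => comp isInternal_lowerPart 0 (f.toAlgHom x) = 0) ?_ ?_ hx
  · intro a b ha hb; rw [map_add, map_add, ha, hb, add_zero]
  intro v y _
  rw [map_mul]
  -- The image of an odd generator has odd degree, so all its components have odd, in particular
  -- positive, lower degree.
  have h1 := degreeSpan_odd_le (f.map_degreeSpan (oddIncl_ι_mem_degreeSpan v))
  generalize f.toAlgHom (oddIncl V (ExteriorAlgebra.ι ℚ v)) = a at h1
  have h2 : (⨆ i, ⨆ _ : ¬ Even i, lowerPart W i) ≤
      LinearMap.ker (comp (isInternal_lowerPart (V := W)) 0 ∘ₗ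
        LinearMap.mulRight ℚ (f.toAlgHom y)) := by
    refine iSup₂_le fun i hi a ha => ?_
    change comp isInternal_lowerPart 0 (a * f.toAlgHom y) = 0
    refine comp_induction isInternal_lowerPart
      (P := fun b : FreeCGA W => comp isInternal_lowerPart 0 (a * b) = 0) ?_ ?_ (f.toAlgHom y)
    · intro b c hb hc; rw [mul_add, map_add, hb, hc, add_zero]
    · intro j b hb
      refine comp_of_mem_ne isInternal_lowerPart ?_ (mul_mem_lowerPart ha hb)
      rintro h
      rw [show i = 0 by omega] at hi
      exact hi (by simp)
  exact h2 h1

end Morphisms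

/-! ### Splittings -/

namespace Splitting

variable {V : ℕ → Type u} [∀ n, AddCommGroup (V n)] [∀ n, Module ℚ (V n)]
variable {V' : ℕ → Type v} [∀ n, AddCommGroup (V' n)] [∀ n, Module ℚ (V' n)]
variable {A : SullivanAlgebra V} {A' : SullivanAlgebra V'} {k : ℕ} {deg : Fin k → ℕ}
  {hdeg : ∀ i, 0 < deg i} (S : Splitting A A' deg hdeg)

/-- The underlying linear isomorphism of a splitting. -/
def equiv : FreeCGA V' ⊗[ℚ] FreeCGA (GenSpace deg) ≃ₗ[ℚ] FreeCGA V :=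
  LinearEquiv.ofBijective _ S.bijective

theorem equiv_tmul (a : FreeCGA V') (b : FreeCGA (GenSpace deg)) :
    S.equiv (a ⊗ₜ b) = S.f.toAlgHom a * S.g.toAlgHom b := rfl

theorem d_g (b : FreeCGA (GenSpace deg)) : A.d (S.g.toAlgHom b) = 0 := by
  rw [← S.g.map_d]
  exact map_zero _

theorem d_equiv (t : FreeCGA V' ⊗[ℚ] FreeCGA (GenSpace deg)) :
    A.d (S.equiv t) = S.equiv (A'.d.rTensor _ t) := by
  induction t using TensorProduct.induction_on with
  | zero => simp
  | add x y hx hy => simp only [map_add, hx, hy]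
  | tmul a b =>
    rw [LinearMap.rTensor_tmul, equiv_tmul, equiv_tmul]
    refine comp_induction isInternal_degreePart (P := fun a => A.d (S.f.toAlgHom a * S.g.toAlgHom b)
      = S.f.toAlgHom (A'.d a) * S.g.toAlgHom b) ?_ ?_ a
    · intro x y hx hy; simp only [map_add, add_mul, hx, hy]
    · intro n a ha
      rw [A.leibniz n _ (S.f.map_degree n a ha), S.d_g, mul_zero, smul_zero, add_zero, S.f.map_d]

theorem rTensor_eq {z : FreeCGA V'} {b : FreeCGA (GenSpace deg)} {w : FreeCGA V}
    (h : A.d w = S.f.toAlgHom z * S.g.toAlgHom b) :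
    A'.d.rTensor _ (S.equiv.symm w) = z ⊗ₜ b := by
  apply S.equiv.injective
  rw [← d_equiv, LinearEquiv.apply_symm_apply, h, equiv_tmul]

/-- The augmentation of Λ⟨x_i⟩ gives a retraction of ΛV onto ΛV' that commutes with the
differentials; applied to w, it yields a primitive in ΛV'. -/
theorem exists_d_eq {z : FreeCGA V'} {w : FreeCGA V} (h : A.d w = S.f.toAlgHom z) :
    ∃ w', A'.d w' = z := by
  have h1 := S.rTensor_eq (z := z) (b := 1) (by rw [h, map_one, mul_one])
  have h2 : ∀ t : FreeCGA V' ⊗[ℚ] FreeCGA (GenSpace deg),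
      TensorProduct.rid ℚ _ ((aug.toLinearMap).lTensor _ (A'.d.rTensor _ t)) =
        A'.d (TensorProduct.rid ℚ _ ((aug.toLinearMap).lTensor _ t)) := by
    intro t
    induction t using TensorProduct.induction_on with
    | zero => simp
    | add x y hx hy => simp only [map_add, hx, hy]
    | tmul a b => simp
  refine ⟨_, (h2 (S.equiv.symm w)).symm.trans ?_⟩
  rw [h1]
  simp

/-- Augmenting the factor ΛV' annihilates all boundaries but fixes Λ⟨x_i⟩. -/
theorem eq_zero_of_d_eq {b : FreeCGA (GenSpace deg)} {w : FreeCGA V}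
    (h : A.d w = S.g.toAlgHom b) : b = 0 := by
  have h1 := S.rTensor_eq (z := 1) (b := b) (by rw [h, map_one, one_mul])
  have h2 : ∀ t : FreeCGA V' ⊗[ℚ] FreeCGA (GenSpace deg),
      TensorProduct.lid ℚ _ ((aug.toLinearMap).rTensor _ (A'.d.rTensor _ t)) = 0 := by
    intro t
    induction t using TensorProduct.induction_on with
    | zero => simp
    | add x y hx hy => simp only [map_add, hx, hy, add_zero]
    | tmul a b => simp [A'.aug_d]
  have h3 := h2 (S.equiv.symm w)
  rw [h1] at h3
  simpa using h3

include S in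
/-- The generators with zero differential of an elliptic algebra have odd degree. -/
theorem not_even_deg [Module.Finite ℚ A.Cohomology] (i : Fin k) : ¬ Even (deg i) := by
  intro hi
  let ξ : FreeCGA (GenSpace deg) := gen (GenSpace deg) (deg i) (Pi.single ⟨i, rfl⟩ 1)
  obtain ⟨N, w, hw⟩ := SullivanAlgebra.exists_pow_mem_range (A := A) (hdeg i)
    (S.g.map_degree _ _ (gen_mem_degreePart (deg i) (Pi.single ⟨i, rfl⟩ 1)))
    (fun j => by rw [← map_pow, S.d_g])
  rw [← map_pow] at hw
  have h0 : ξ ^ N = 0 := S.eq_zero_of_d_eq hw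
  -- Evaluation at x_i = 1, with the other generators sent to 0, shows that no power of x_i is zero.
  let e : EvenPart (GenSpace deg) →ₗ[ℚ] ℚ := DirectSum.toModule ℚ _ ℚ fun n =>
    if h : deg i = n.1 then LinearMap.proj ⟨i, h⟩ else 0
  have h1 : lift 0 (by simp) e ξ = 1 := by
    rw [lift_gen_even hi, DirectSum.toModule_lof, dif_pos rfl]
    simp
  have h2 := congrArg (lift 0 (by simp) e) h0
  rw [map_pow, h1, one_pow, map_zero] at h2
  exact one_ne_zero h2

theorem induction {P : FreeCGA V → Prop} (hadd : ∀ a b, P a → P b → P (a + b))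
    (hmul : ∀ i, ∀ a ∈ degreePart V' i, ∀ j, ∀ b ∈ degreePart (GenSpace deg) j,
      P (S.f.toAlgHom a * S.g.toAlgHom b)) (x : FreeCGA V) : P x := by
  obtain ⟨t, rfl⟩ := S.equiv.surjective x
  induction t using TensorProduct.induction_on with
  | zero =>
    have := hmul 0 0 (zero_mem _) 0 0 (zero_mem _)
    rwa [map_zero, zero_mul, ← map_zero S.equiv] at this
  | add x y hx hy => rw [map_add]; exact hadd _ _ hx hy
  | tmul a b =>
    rw [equiv_tmul]
    refine comp_induction isInternal_degreePart
      (P := fun a => P (S.f.toAlgHom a * S.g.toAlgHom b)) ?_ (fun i a ha => ?_) a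
    · intro x y hx hy; rw [map_add, add_mul]; exact hadd _ _ hx hy
    refine comp_induction isInternal_degreePart
      (P := fun b => P (S.f.toAlgHom a * S.g.toAlgHom b)) ?_ (fun j b hb => hmul i a ha j b hb) b
    intro x y hx hy; rw [map_add, mul_add]; exact hadd _ _ hx hy

/-- The target of the linear part of the algebra `ΛV' ⊗ Λ⟨x_1, …, x_k⟩`. -/
abbrev PairExt (V' : ℕ → Type v) [∀ n, AddCommGroup (V' n)] [∀ n, Module ℚ (V' n)]
    (deg : Fin k → ℕ) : Type v := TrivSqZeroExt ℚ (Gens V' × Gens (GenSpace deg))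

/-- The linear part of `ΛV'`, inside `PairExt`. -/
def linLeft (V' : ℕ → Type v) [∀ n, AddCommGroup (V' n)] [∀ n, Module ℚ (V' n)]
    (deg : Fin k → ℕ) : FreeCGA V' →ₐ[ℚ] PairExt V' deg :=
  (TrivSqZeroExt.map (LinearMap.inl ℚ (Gens V') (Gens (GenSpace deg)))).comp (linPart V')

/-- The linear part of `Λ⟨x_1, …, x_k⟩`, inside `PairExt`. -/
def linRight (V' : ℕ → Type v) [∀ n, AddCommGroup (V' n)] [∀ n, Module ℚ (V' n)]
    (deg : Fin k → ℕ) : FreeCGA (GenSpace deg) →ₐ[ℚ] PairExt V' deg :=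
  (TrivSqZeroExt.map (LinearMap.inr ℚ (Gens V') (Gens (GenSpace deg)))).comp
    (linPart (GenSpace deg))

theorem fst_linLeft (a : FreeCGA V') : (linLeft V' deg a).fst = aug a := by
  rw [linLeft, AlgHom.comp_apply, TrivSqZeroExt.fst_map, fst_linPart]

theorem fst_linRight (b : FreeCGA (GenSpace deg)) : (linRight V' deg b).fst = aug b := by
  rw [linRight, AlgHom.comp_apply, TrivSqZeroExt.fst_map, fst_linPart]

/-- The linear part of `ΛV' ⊗ Λ⟨x_1, …, x_k⟩`, transported to `ΛV`. -/
def linBoth : FreeCGA V →ₗ[ℚ] PairExt V' deg :=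
  (LinearMap.mul' ℚ (PairExt V' deg) ∘ₗ
    TensorProduct.map (linLeft V' deg).toLinearMap (linRight V' deg).toLinearMap) ∘ₗ
      S.equiv.symm.toLinearMap

theorem linBoth_mul (a : FreeCGA V') (b : FreeCGA (GenSpace deg)) :
    S.linBoth (S.f.toAlgHom a * S.g.toAlgHom b) = linLeft V' deg a * linRight V' deg b := by
  rw [← equiv_tmul, linBoth, LinearMap.comp_apply, LinearEquiv.coe_coe,
    LinearEquiv.symm_apply_apply]
  rfl

/-- Exchanging b₁ and a₂ costs a sign. The sign is -1 only if both degrees are odd; then both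
augmentations vanish and the product of the linear parts is zero, so the sign does no harm. -/
theorem linBoth_map_mul (x y : FreeCGA V) : S.linBoth (x * y) = S.linBoth x * S.linBoth y := by
  refine S.induction (P := fun x => S.linBoth (x * y) = S.linBoth x * S.linBoth y) ?_ ?_ x
  · intro a b ha hb; rw [add_mul, map_add, map_add, ha, hb, add_mul]
  intro i₁ a₁ ha₁ j₁ b₁ hb₁
  refine S.induction (P := fun y => S.linBoth (_ * y) = _ * S.linBoth y) ?_ ?_ y
  · intro a b ha hb; rw [mul_add, map_add, map_add, ha, hb, mul_add]
  intro i₂ a₂ ha₂ j₂ b₂ hb₂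
  have h1 : S.f.toAlgHom a₁ * S.g.toAlgHom b₁ * (S.f.toAlgHom a₂ * S.g.toAlgHom b₂) =
      (-1 : ℚ) ^ (j₁ * i₂) • (S.f.toAlgHom (a₁ * a₂) * S.g.toAlgHom (b₁ * b₂)) := by
    rw [mul_assoc, ← mul_assoc (S.g.toAlgHom b₁),
      degreePart_comm (S.g.map_degree _ _ hb₁) (S.f.map_degree _ _ ha₂), smul_mul_assoc,
      mul_smul_comm, map_mul, map_mul]
    simp only [mul_assoc]
  rw [h1, map_smul, linBoth_mul, linBoth_mul, linBoth_mul, map_mul, map_mul]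
  by_cases h : Even (j₁ * i₂)
  · rw [h.neg_one_pow, one_smul]; ring
  · have h3 : linLeft V' deg a₂ * linRight V' deg b₁ = 0 := by
      rw [Nat.not_even_iff_odd, Nat.odd_mul] at h
      have e1 := fst_linLeft (deg := deg) a₂
      have e2 := fst_linRight (V' := V') b₁
      rw [aug_of_mem (by rintro rfl; simpa using h.2) ha₂] at e1
      rw [aug_of_mem (by rintro rfl; simpa using h.1) hb₁] at e2
      refine TrivSqZeroExt.ext ?_ ?_
      · rw [TrivSqZeroExt.fst_mul, e1, zero_mul]; rfl
      · rw [TrivSqZeroExt.snd_mul, e1, e2]; simp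
    rw [show linLeft V' deg a₁ * linLeft V' deg a₂ * (linRight V' deg b₁ * linRight V' deg b₂) =
        linLeft V' deg a₁ * (linLeft V' deg a₂ * linRight V' deg b₁) * linRight V' deg b₂ by ring,
      show linLeft V' deg a₁ * linRight V' deg b₁ * (linLeft V' deg a₂ * linRight V' deg b₂) =
        linLeft V' deg a₁ * (linLeft V' deg a₂ * linRight V' deg b₁) * linRight V' deg b₂ by ring,
      h3, mul_zero, zero_mul, smul_zero]

/-- The linear part of `ΛV' ⊗ Λ⟨x_1, …, x_k⟩`, as a homomorphism of algebras on `ΛV`. -/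
def linHom : FreeCGA V →ₐ[ℚ] PairExt V' deg :=
  AlgHom.ofLinearMap S.linBoth
    (by have := S.linBoth_mul 1 1; simpa only [map_one, mul_one] using this) S.linBoth_map_mul

theorem linHom_f (a : FreeCGA V') : S.linHom (S.f.toAlgHom a) = linLeft V' deg a := by
  change S.linBoth _ = _
  have := S.linBoth_mul a 1
  simpa only [map_one, mul_one] using this

theorem linHom_g (b : FreeCGA (GenSpace deg)) : S.linHom (S.g.toAlgHom b) = linRight V' deg b := by
  change S.linBoth _ = _
  have := S.linBoth_mul 1 b
  simpa only [map_one, one_mul] using this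

theorem fst_linHom (x : FreeCGA V) : (S.linHom x).fst = aug x := by
  refine S.induction (P := fun x => (S.linHom x).fst = aug x) ?_ ?_ x
  · intro a b ha hb; rw [map_add, map_add, TrivSqZeroExt.fst_add, ha, hb]
  · intro i a _ j b _
    rw [map_mul, map_mul, linHom_f, linHom_g, TrivSqZeroExt.fst_mul, fst_linLeft, fst_linRight,
      DGHom.aug_map, DGHom.aug_map]

/-- The generators of the factors of a splitting are the generators of the total algebra. -/
theorem exists_gens_equiv : ∃ (Rf : Gens V' →ₗ[ℚ] Gens V) (Rg : Gens (GenSpace deg) →ₗ[ℚ] Gens V),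
    Function.Bijective (Rf.coprod Rg) ∧
    (∀ a, linPart V (S.f.toAlgHom a) = TrivSqZeroExt.map Rf (linPart V' a)) ∧
    (∀ b, linPart V (S.g.toAlgHom b) = TrivSqZeroExt.map Rg (linPart (GenSpace deg) b)) := by
  obtain ⟨Rf, hf⟩ := exists_map_linPart ((linPart V).comp S.f.toAlgHom) fun n x => by
    rw [AlgHom.comp_apply, fst_linPart, DGHom.aug_map, aug_gen]
  obtain ⟨Rg, hg⟩ := exists_map_linPart ((linPart V).comp S.g.toAlgHom) fun n x => by
    rw [AlgHom.comp_apply, fst_linPart, DGHom.aug_map, aug_gen]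
  -- The linear part of the inverse isomorphism; R is a left inverse of `Rf.coprod Rg`.
  obtain ⟨R, hR⟩ := exists_map_linPart S.linHom fun n x => by rw [fst_linHom, aug_gen]
  have hf' : ∀ a, linPart V (S.f.toAlgHom a) = TrivSqZeroExt.map Rf (linPart V' a) :=
    AlgHom.congr_fun hf
  have hg' : ∀ b, linPart V (S.g.toAlgHom b) = TrivSqZeroExt.map Rg (linPart (GenSpace deg) b) :=
    AlgHom.congr_fun hg
  refine ⟨Rf, Rg, ⟨?_, ?_⟩, hf', hg'⟩
  · have h1 : ∀ x, R (Rf x) = (x, 0) := by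
      intro x
      obtain ⟨a, ha⟩ := exists_linPart_eq x
      have e := AlgHom.congr_fun hR (S.f.toAlgHom a)
      rw [linHom_f, AlgHom.comp_apply, hf', linLeft, AlgHom.comp_apply, ha, TrivSqZeroExt.map_inr,
        TrivSqZeroExt.map_inr, TrivSqZeroExt.map_inr] at e
      exact (TrivSqZeroExt.inr_injective e).symm
    have h2 : ∀ x, R (Rg x) = (0, x) := by
      intro x
      obtain ⟨a, ha⟩ := exists_linPart_eq x
      have e := AlgHom.congr_fun hR (S.g.toAlgHom a)
      rw [linHom_g, AlgHom.comp_apply, hg', linRight, AlgHom.comp_apply, ha, TrivSqZeroExt.map_inr,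
        TrivSqZeroExt.map_inr, TrivSqZeroExt.map_inr] at e
      exact (TrivSqZeroExt.inr_injective e).symm
    refine Function.LeftInverse.injective (g := R) fun x => ?_
    rw [LinearMap.coprod_apply, map_add, h1, h2]
    simp
  · intro x
    obtain ⟨a, ha⟩ := exists_linPart_eq x
    -- The linear part of a product f(a) g(b) is a combination of the linear parts of its factors,
    -- and such products span ΛV.
    have h3 : (linPart V a).snd ∈ LinearMap.range (Rf.coprod Rg) := by
      refine S.induction (P := fun a => (linPart V a).snd ∈ LinearMap.range (Rf.coprod Rg)) ?_ ?_ a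
      · intro a b ha hb; rw [map_add, TrivSqZeroExt.snd_add]; exact add_mem ha hb
      · intro i a _ j b _
        rw [map_mul, TrivSqZeroExt.snd_mul, hf', hg', TrivSqZeroExt.snd_map, TrivSqZeroExt.snd_map,
          op_smul_eq_smul]
        refine add_mem (Submodule.smul_mem _ _ ⟨(0, (linPart _ b).snd), ?_⟩)
          (Submodule.smul_mem _ _ ⟨((linPart _ a).snd, 0), ?_⟩)
        · rw [LinearMap.coprod_apply, map_zero, zero_add]
        · rw [LinearMap.coprod_apply, map_zero, add_zero]
    rw [ha, TrivSqZeroExt.snd_inr] at h3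
    exact h3

end Splitting

/-! ### Additivity of the homotopy Euler characteristic and the surviving class -/

theorem finrank_oddPart_genSpace {k : ℕ} {deg : Fin k → ℕ} (h : ∀ i, ¬ Even (deg i)) :
    Module.Finite ℚ (OddPart (GenSpace deg)) ∧ Module.finrank ℚ (OddPart (GenSpace deg)) = k := by
  let b : Module.Basis (Σ n : {n : ℕ // ¬ Even n}, {i : Fin k // deg i = n.1}) ℚ
      (OddPart (GenSpace deg)) := DFinsupp.basis fun n => Pi.basisFun ℚ {i : Fin k // deg i = n.1}
  let e : (Σ n : {n : ℕ // ¬ Even n}, {i : Fin k // deg i = n.1}) ≃ Fin k :=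
    { toFun := fun x => x.2.1
      invFun := fun i => ⟨⟨deg i, h i⟩, ⟨i, rfl⟩⟩
      left_inv := by rintro ⟨⟨n, hn⟩, ⟨i, hi⟩⟩; obtain rfl : deg i = n := hi; rfl
      right_inv := fun _ => rfl }
  refine ⟨Module.Finite.of_basis (b.reindex e), ?_⟩
  rw [Module.finrank_eq_card_basis (b.reindex e), Fintype.card_fin]

theorem subsingleton_evenPart_genSpace {k : ℕ} {deg : Fin k → ℕ} (h : ∀ i, ¬ Even (deg i)) :
    Subsingleton (EvenPart (GenSpace deg)) := by
  refine ⟨fun x y => DFinsupp.ext fun n => funext fun i => ?_⟩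
  have := n.2
  rw [← i.2] at this
  exact absurd this (h i.1)

namespace Splitting

variable {V : ℕ → Type u} [∀ n, AddCommGroup (V n)] [∀ n, Module ℚ (V n)]
variable {V' : ℕ → Type v} [∀ n, AddCommGroup (V' n)] [∀ n, Module ℚ (V' n)]
variable {A : SullivanAlgebra V} {A' : SullivanAlgebra V'} {k : ℕ} {deg : Fin k → ℕ}
  {hdeg : ∀ i, 0 < deg i}

/-- Morphisms preserve degree, so the isomorphism on generators respects parity. Surjectivity in
each parity gives two inequalities of dimensions, and equality of the total dimensions makes both
sharp. -/
theorem homotopyEuler_eq (S : Splitting A A' deg hdeg) (hA : A.IsElliptic) (hA' : A'.IsElliptic) :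
    A.homotopyEuler = k + A'.homotopyEuler := by
  obtain ⟨hV, hH⟩ := hA
  obtain ⟨hV', _⟩ := hA'
  have hodd : ∀ i, ¬ Even (deg i) := S.not_even_deg
  have := finite_evenPart hV
  have := finite_oddPart hV
  have := finite_evenPart hV'
  have := finite_oddPart hV'
  obtain ⟨_, hk⟩ := finrank_oddPart_genSpace hodd
  have := subsingleton_evenPart_genSpace hodd
  obtain ⟨Rf, Rg, hbij, hf, hg⟩ := S.exists_gens_equiv
  have hfo : ∀ v, (Rf (oddToGens V' v) : OddPart V × EvenPart V).2 = 0 := fun v => by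
    have h := hf (oddGen v)
    rw [linPart_oddGen, TrivSqZeroExt.map_inr] at h
    have := linPart_odd (S.f.map_degreeSpan (oddIncl_ι_mem_degreeSpan v))
    rw [← oddGen_apply, h] at this
    exact this
  have hfe : ∀ v, (Rf (evenToGens V' v) : OddPart V × EvenPart V).1 = 0 := fun v => by
    have h := hf (evenIncl V' (SymmetricAlgebra.ι ℚ _ v))
    rw [linPart_evenIncl_ι, TrivSqZeroExt.map_inr] at h
    have := linPart_even (S.f.map_degreeSpan (evenIncl_mem_degreeSpan (SymmetricAlgebra.ι ℚ _ v)))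
    rw [h] at this
    exact this
  have hgo : ∀ v, (Rg (oddToGens _ v) : OddPart V × EvenPart V).2 = 0 := fun v => by
    have h := hg (oddGen v)
    rw [linPart_oddGen, TrivSqZeroExt.map_inr] at h
    have := linPart_odd (S.g.map_degreeSpan (oddIncl_ι_mem_degreeSpan v))
    rw [← oddGen_apply, h] at this
    exact this
  have hdec : ∀ (x : Gens V'), x = oddToGens V' x.1 + evenToGens V' x.2 := fun x =>
    Prod.ext (add_zero x.1).symm (zero_add x.2).symm
  have hdecX : ∀ (x : Gens (GenSpace deg)), x = oddToGens _ x.1 := fun x =>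
    Prod.ext rfl (Subsingleton.elim _ _)
  let pO : Gens V →ₗ[ℚ] OddPart V := LinearMap.fst ℚ (OddPart V) (EvenPart V)
  let pE : Gens V →ₗ[ℚ] EvenPart V := LinearMap.snd ℚ (OddPart V) (EvenPart V)
  have h1 : Function.Surjective (((pO ∘ₗ Rf ∘ₗ oddToGens V').coprod
      (pO ∘ₗ Rg ∘ₗ oddToGens (GenSpace deg)))) := by
    intro v
    obtain ⟨⟨a, b⟩, hab⟩ := hbij.2 (oddToGens V v)
    refine ⟨(a.1, b.1), ?_⟩
    have h := congrArg pO hab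
    rw [LinearMap.coprod_apply, hdec a, hdecX b, map_add, map_add, map_add,
      show pO (Rf (evenToGens V' a.2)) = 0 from hfe _, add_zero] at h
    exact h
  have h2 : Function.Surjective (pE ∘ₗ Rf ∘ₗ evenToGens V') := by
    intro v
    obtain ⟨⟨a, b⟩, hab⟩ := hbij.2 (evenToGens V v)
    refine ⟨a.2, ?_⟩
    have h := congrArg pE hab
    rw [LinearMap.coprod_apply, hdec a, hdecX b, map_add, map_add, map_add,
      show pE (Rf (oddToGens V' a.1)) = 0 from hfo _, show pE (Rg (oddToGens _ b.1)) = 0 from hgo _,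
      add_zero, zero_add] at h
    exact h
  have e1 := LinearMap.finrank_le_finrank_of_surjective h1
  have e2 := LinearMap.finrank_le_finrank_of_surjective h2
  have e3 : Module.finrank ℚ ((OddPart V' × EvenPart V') ×
      (OddPart (GenSpace deg) × EvenPart (GenSpace deg))) =
      Module.finrank ℚ (OddPart V × EvenPart V) :=
    (LinearEquiv.ofBijective (Rf.coprod Rg) hbij).finrank_eq
  rw [Module.finrank_prod] at e1
  rw [Module.finrank_prod, Module.finrank_prod, Module.finrank_prod, Module.finrank_prod,
    Module.finrank_zero_of_subsingleton (M := EvenPart (GenSpace deg))] at e3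
  rw [SullivanAlgebra.homotopyEuler, SullivanAlgebra.homotopyEuler]
  omega

/-- The nonzero class of lower degree 2 serves, with s = 2. Its image is not a boundary, by the
retraction onto ΛV', and has no component in lower degree 0. -/
theorem exists_class (S : Splitting A A' deg hdeg) (hA : A.IsPure) (hA' : A'.IsPure)
    (hE : A'.IsElliptic) (h : 1 < A'.homotopyEuler) :
    ∃ s : ℕ, 0 < s ∧ ∃ x : A'.Cohomology, x ≠ 0 ∧ x ∈ A'.lowerH s ∧ x ∈ A'.evenH ∧
      x ∉ A'.lowerH 0 ∧ S.f.cohomologyMap x ∉ A.lowerH 0 := by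
  obtain ⟨z, hz, hdz, hne⟩ := hA'.exists_nonzero_two hE h
  refine ⟨2, by norm_num, A'.cls z hdz, ?_, SullivanAlgebra.mem_classesIn.2 ⟨z, hz, hdz, rfl⟩,
    SullivanAlgebra.mem_evenH_iff.2 ⟨z, lowerPart_two_le hz, hdz, rfl⟩,
    hA'.not_mem_lowerH_zero hdz (comp_of_mem_ne _ (by norm_num) hz) hne, ?_⟩
  · rw [Ne, SullivanAlgebra.cls_eq_zero_iff]
    rintro ⟨w, hw⟩
    exact hne w hw
  · refine hA.not_mem_lowerH_zero (z := S.f.toAlgHom z) (by rw [← S.f.map_d, hdz, map_zero])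
      (S.f.comp_zero_map_eq_zero hz) fun w hw => ?_
    obtain ⟨w', hw'⟩ := S.exists_d_eq hw
    exact hne w' hw'

end Splitting

end RHT

end

theorem mainTheorem10 {V : ℕ → Type*} [∀ n, AddCommGroup (V n)] [∀ n, Module ℚ (V n)]
    (A : RHT.SullivanAlgebra V) (hpure : A.IsPure) (hell : A.IsElliptic) :
    (A.lowerH 0 = A.evenH ↔ A.homotopyEuler ≤ 1) ∧
    (A.IsMinimal →
      ∀ (V' : ℕ → Type*) [∀ n, AddCommGroup (V' n)] [∀ n, Module ℚ (V' n)]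
        (A' : RHT.SullivanAlgebra V'), A'.IsPure → A'.IsMinimal → A'.IsElliptic →
      ∀ (k : ℕ) (deg : Fin k → ℕ) (hdeg : ∀ i, 0 < deg i)
        (S : RHT.Splitting A A' deg hdeg),
        (A.lowerH 0 = A.evenH ↔ (k : ℤ) + A'.homotopyEuler ≤ 1) ∧
        ((k : ℤ) + A'.homotopyEuler ≤ 1 ↔ A.homotopyEuler ≤ 1) ∧
        (A'.homotopyEuler ≤ 1 → A'.evenH = A'.lowerH 0) ∧
        (1 < A'.homotopyEuler →
          ∃ s : ℕ, 0 < s ∧ ∃ x : A'.Cohomology, x ≠ 0 ∧ x ∈ A'.lowerH s ∧ x ∈ A'.evenH ∧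
            x ∉ A'.lowerH 0 ∧ S.f.cohomologyMap x ∉ A.lowerH 0)) := by
  have hA := hpure.lowerH_zero_eq_evenH_iff hell
  refine ⟨hA, fun _ V' _ _ A' hpure' _ hell' k deg hdeg S => ?_⟩
  rw [← S.homotopyEuler_eq hell hell']
  exact ⟨hA, Iff.rfl, fun h => ((hpure'.lowerH_zero_eq_evenH_iff hell').2 h).symm,
    S.exists_class hpure hpure' hell'⟩
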